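/- Let $a>0$ and $N,s\in\mathbb R$, let $I=(s-\tfrac12,s+\tfrac12)$ (for $s=0$ this is $(-\tfrac12,\tfrac12)$, for $s=\tfrac12$ it is $(0,1)$), write $D=d/dx$, and consider complex-valued functions on $I$. Let $$\mathcal D=\{w=(W,\Theta)\in H^4(I)\times H^2(I):\ W=DW=\Theta=0 \text{ at } x=s\pm\tfrac12\}\subset L^2(I)^2,$$ $$A=\begin{pmatrix}(D^2-a^2)^2&0\\0&D^2-a^2\end{pmatrix},\quad K=\begin{pmatrix}0&1\\N(x-s)-1&0\end{pmatrix},\quad A_+=JA,\quad K_+=JK,\quad J=\begin{pmatrix}1&0\\0&-1\end{pmatrix},$$ so that $A_+=\mathrm{diag}((D^2-a^2)^2,\,a^2-D^2)$, and $Aw=\lambda Kw$ and $A_+w=\lambda K_+w$ are the same problem (the second equation is multiplied by $-1$). Then: 1. $A_+$, with domain $\mathcal D$ (which is dense in $L^2(I)^2$), is self-adjoint and positive-definite: there is $\gamma>0$ with $(A_+w,w)\ge\gamma\|w\|_{L^2}^2$ for all $w\in\mathcal D$. Let $H_0$ be the completion of $\mathcal D$ in the energy norm $(A_+w,w)^{1/2}$.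 2. $A$ is self-adjoint on $\mathcal D$ and maps $\mathcal D$ bijectively onto $L^2(I)^2$. The operator $A^{-1}K=A_+^{-1}K_+$ extends from $\mathcal D$ to a compact operator on $H_0$, and it is also compact on $L^2(I)^2$. 3. Let $X_n\subset\mathcal D$ ($n\in\mathbb N$) be finite-dimensional trial spaces that are complete in $H_0$, i.e. for every $u\in\mathcal D$ the energy distance from $u$ to $X_n$ tends to $0$. Call $\mu\in\mathbb C$ a Galerkin eigenvalue on $X_n$ with Galerkin eigenvector $v$ if $0\ne v\in X_n$ and the residual of the equation at $(\mu,v)$ is $L^2$-orthogonal to $X_n$. Then the Galerkin method for $A_+w=\lambda K_+w$ converges, in the following sense: (i) every eigenvalue is the limit of a sequence $\mu_n$ of complex numbers such that $\mu_n$ is a Galerkin eigenvalue on $X_n$ for all large $n$; (ii) if $n_k\to\infty$ and $\mu_k$ are Galerkin eigenvalues on $X_{n_k}$ with $\mu_k\to\mu$, then $\mu$ is an eigenvalue; (iii) in the situation of (ii), for any corresponding Galerkin eigenvectors $v_k$ there are elements $w_k\in\mathcal D$, which are eigenvectors for $\mu$ for all large $k$, such that $\|v_k-w_k\|/\|v_k\|\to0$,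 both in the norm of $H_0$ and in the norm of $L^2(I)^2$. 4. If moreover $W$ and $\Theta$ are expanded separately, i.e. each $X_n$ consists of the $w\in\mathcal D$ with $W\in V_n$ and $\Theta\in T_n$ for linear subspaces $V_n,T_n$ of $L^2(I)$, then the Galerkin method converges in the sense of (i)–(iii) also for $Aw=\lambda Kw$, and for the system $$(D^2-a^2)^2W=\Theta,\qquad (D^2-a^2)\Theta=-a^2R\,(1-N(x-s))\,W$$ with eigenvalue $R$. -/

import Mathlib

open MeasureTheory
open scoped InnerProductSpace ComplexConjugate

noncomputable section

namespace Convection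

/-- Lebesgue measure on the interval `(s - 1/2, s + 1/2)`. -/
def vol (s : ℝ) : Measure ℝ := volume.restrict (Set.Ioo (s - 1 / 2) (s + 1 / 2))

instance (s : ℝ) : IsFiniteMeasure (vol s) := by
  unfold vol; infer_instance

instance (s : ℝ) : NullSingletonClass (vol s) := by
  unfold vol; infer_instance

/-- Complex `L²(s - 1/2, s + 1/2)`. -/
abbrev L2 (s : ℝ) : Type := Lp ℂ 2 (vol s)

/-- The Hilbert space `L²(s - 1/2, s + 1/2)²` of pairs `w = (W, Θ)`. -/
abbrev H (s : ℝ) : Type := WithLp 2 (L2 s × L2 s)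

/-- `F` is absolutely continuous on `[s - 1/2, s + 1/2]` with derivative `f ∈ L²`. -/
structure HasL2Deriv (s : ℝ) (F f : ℝ → ℂ) : Prop where
  memLp : MemLp f 2 (vol s)
  eq_integral : ∀ x ∈ Set.Icc (s - 1 / 2) (s + 1 / 2),
    F x = F (s - 1 / 2) + ∫ t in (s - 1 / 2)..x, f t

lemma integral_Iic_vol (s : ℝ) (f : ℝ → ℂ) {x : ℝ} (hx : x ∈ Set.Icc (s - 1 / 2) (s + 1 / 2)) :
    ∫ t in (s - 1 / 2)..x, f t = ∫ t in Set.Iic x, f t ∂(vol s) := by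
  rw [intervalIntegral.integral_of_le hx.1, vol, Measure.restrict_restrict measurableSet_Iic]
  refine setIntegral_congr_set ?_
  have h : Set.Ioc (s - 1 / 2) x = Set.Iic x ∩ Set.Ioc (s - 1 / 2) (s + 1 / 2) := by
    ext t
    simp only [Set.mem_Ioc, Set.mem_inter_iff, Set.mem_Iic]
    exact ⟨fun ⟨h1, h2⟩ => ⟨h2, h1, h2.trans hx.2⟩, fun ⟨h1, h2, _⟩ => ⟨h2, h1⟩⟩
  rw [h]
  exact (Filter.EventuallyEq.refl _ _).inter Ioo_ae_eq_Ioc.symm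

lemma HasL2Deriv.integrable {s : ℝ} {F f : ℝ → ℂ} (h : HasL2Deriv s F f) :
    Integrable f (vol s) := h.memLp.integrable (by norm_num)

lemma parts_aux {μ : Measure ℝ} [IsFiniteMeasure μ] [NullSingletonClass μ] {f g : ℝ → ℂ}
    (hf : Integrable f μ) (hg : Integrable g μ) :
    ∫ x, f x * (∫ t in Set.Iic x, g t ∂μ) ∂μ + ∫ x, (∫ t in Set.Iic x, f t ∂μ) * g x ∂μ
      = (∫ x, f x ∂μ) * ∫ x, g x ∂μ := by
  have hm : MeasurableSet {p : ℝ × ℝ | p.1 ≤ p.2} := measurableSet_le measurable_fst measurable_snd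
  have hm' : MeasurableSet {p : ℝ × ℝ | p.2 ≤ p.1} := measurableSet_le measurable_snd measurable_fst
  set A : ℝ × ℝ → ℂ := {p : ℝ × ℝ | p.2 ≤ p.1}.indicator (fun p => f p.1 * g p.2) with hA
  set B : ℝ × ℝ → ℂ := {p : ℝ × ℝ | p.1 ≤ p.2}.indicator (fun p => f p.1 * g p.2) with hB
  have hi := hf.mul_prod hg
  have hAi : Integrable A (μ.prod μ) := hi.indicator hm'
  have hBi : Integrable B (μ.prod μ) := hi.indicator hm
  have e1 : ∀ x, f x * (∫ t in Set.Iic x, g t ∂μ) = ∫ t, A (x, t) ∂μ := by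
    intro x
    rw [← integral_indicator measurableSet_Iic, ← integral_const_mul]
    refine integral_congr_ae (Filter.Eventually.of_forall fun t => ?_)
    by_cases h : t ≤ x <;> simp [hA, Set.indicator, h]
  have e2 : ∀ x, (∫ t in Set.Iic x, f t ∂μ) * g x = ∫ t, B (t, x) ∂μ := by
    intro x
    rw [← integral_indicator measurableSet_Iic, ← integral_mul_const]
    refine integral_congr_ae (Filter.Eventually.of_forall fun t => ?_)
    by_cases h : t ≤ x <;> simp [hB, Set.indicator, h]
  simp_rw [e1, e2]
  rw [← integral_prod A hAi, ← integral_prod_symm B hBi, ← integral_add hAi hBi,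
    ← integral_prod_mul]
  have hd : ∀ᵐ p ∂(μ.prod μ), p.1 ≠ p.2 := by
    rw [ae_iff]
    simp only [ne_eq, not_not]
    rw [Measure.measure_prod_null (measurableSet_eq_fun measurable_fst measurable_snd)]
    refine Filter.Eventually.of_forall fun x => ?_
    have : Prod.mk x ⁻¹' {a : ℝ × ℝ | a.1 = a.2} = {x} := by
      ext y
      simp [eq_comm]
    change μ (Prod.mk x ⁻¹' {a : ℝ × ℝ | a.1 = a.2}) = 0
    rw [this]
    simp
  refine integral_congr_ae ?_
  filter_upwards [hd] with p hp
  rcases lt_or_gt_of_ne hp with h | h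
  · simp [hA, hB, h.le, not_le.2 h]
  · simp [hA, hB, h.le, not_le.2 h]


lemma HasL2Deriv.continuousOn {s : ℝ} {F f : ℝ → ℂ} (h : HasL2Deriv s F f) :
    ContinuousOn F (Set.Icc (s - 1 / 2) (s + 1 / 2)) := by
  have hi : IntegrableOn f (Set.Icc (s - 1 / 2) (s + 1 / 2)) := by
    rw [integrableOn_Icc_iff_integrableOn_Ioo]
    exact h.integrable
  have hle : s - 1 / 2 ≤ s + 1 / 2 := by linarith
  have hp := intervalIntegral.continuousOn_primitive_interval (f := f) (μ := volume)
    (a := s - 1 / 2) (b := s + 1 / 2) (by rwa [Set.uIcc_of_le hle])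
  rw [Set.uIcc_of_le hle] at hp
  have hc : ContinuousOn (fun x => F (s - 1 / 2) + ∫ t in (s - 1 / 2)..x, f t)
      (Set.Icc (s - 1 / 2) (s + 1 / 2)) :=
    continuousOn_const.add hp
  exact hc.congr h.eq_integral

lemma HasL2Deriv.ae_zero {s : ℝ} {F f : ℝ → ℂ} (h : HasL2Deriv s F f)
    (h0 : ∀ x ∈ Set.Icc (s - 1 / 2) (s + 1 / 2), F x = 0) : f =ᵐ[vol s] 0 := by
  have hle : s - 1 / 2 ≤ s + 1 / 2 := by linarith
  have hi : IntervalIntegrable f volume (s - 1 / 2) (s + 1 / 2) := by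
    rw [intervalIntegrable_iff_integrableOn_Ioo_of_le hle]
    exact h.integrable
  rw [vol, Filter.EventuallyEq, ae_restrict_iff' measurableSet_Ioo]
  filter_upwards [hi.ae_hasDerivAt_integral] with x hx hxI
  have hd := hx (by rw [Set.uIcc_of_le hle]; exact Set.Ioo_subset_Icc_self hxI) (s - 1 / 2)
    Set.left_mem_uIcc
  have hz : (fun x => ∫ t in (s - 1 / 2)..x, f t) =ᶠ[nhds x] fun _ => 0 := by
    filter_upwards [isOpen_Ioo.mem_nhds hxI] with y hy
    have hy' := Set.Ioo_subset_Icc_self hy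
    have := h.eq_integral y hy'
    rw [h0 y hy', h0 _ (Set.left_mem_Icc.2 hle), zero_add] at this
    exact this.symm
  exact (hd.congr_of_eventuallyEq hz.symm).unique (hasDerivAt_const x 0)

lemma HasL2Deriv.zero_of_ae {s : ℝ} {F f : ℝ → ℂ} (h : HasL2Deriv s F f)
    (h0 : F =ᵐ[vol s] 0) : ∀ x ∈ Set.Icc (s - 1 / 2) (s + 1 / 2), F x = 0 := by
  have h1 : F =ᵐ[volume.restrict (Set.Icc (s - 1 / 2) (s + 1 / 2))] fun _ => (0 : ℂ) := by
    rw [← restrict_Ioo_eq_restrict_Icc]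
    exact h0
  exact Measure.eqOn_Icc_of_ae_eq volume (by linarith) h1 h.continuousOn continuousOn_const

lemma HasL2Deriv.add {s : ℝ} {F f G g : ℝ → ℂ} (hF : HasL2Deriv s F f) (hG : HasL2Deriv s G g) :
    HasL2Deriv s (F + G) (f + g) where
  memLp := hF.memLp.add hG.memLp
  eq_integral x hx := by
    have e := integral_Iic_vol s (f + g) hx
    simp only [Pi.add_apply] at e ⊢
    rw [e, integral_add hF.integrable.integrableOn hG.integrable.integrableOn,
      hF.eq_integral x hx, hG.eq_integral x hx, integral_Iic_vol s f hx, integral_Iic_vol s g hx]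
    ring

lemma HasL2Deriv.smul {s : ℝ} {F f : ℝ → ℂ} (c : ℂ) (hF : HasL2Deriv s F f) :
    HasL2Deriv s (c • F) (c • f) where
  memLp := hF.memLp.const_smul c
  eq_integral x hx := by
    simp only [Pi.smul_apply]
    rw [intervalIntegral.integral_smul, hF.eq_integral x hx, smul_add]

lemma HasL2Deriv.eq_left_add {s : ℝ} {F f : ℝ → ℂ} (h : HasL2Deriv s F f) :
    ∀ x ∈ Set.Icc (s - 1 / 2) (s + 1 / 2),
      F x = F (s - 1 / 2) + ∫ t in Set.Iic x, f t ∂(vol s) := fun x hx => by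
  rw [← integral_Iic_vol s f hx, ← h.eq_integral x hx]

lemma HasL2Deriv.eq_right {s : ℝ} {F f : ℝ → ℂ} (h : HasL2Deriv s F f) :
    F (s + 1 / 2) = F (s - 1 / 2) + ∫ t, f t ∂(vol s) := by
  have hle : s - 1 / 2 ≤ s + 1 / 2 := by linarith
  rw [h.eq_integral _ (Set.right_mem_Icc.2 hle), intervalIntegral.integral_of_le hle,
    integral_Ioc_eq_integral_Ioo, vol]

lemma HasL2Deriv.conj {s : ℝ} {F f : ℝ → ℂ} (h : HasL2Deriv s F f) :
    HasL2Deriv s (fun x => conj (F x)) (fun x => conj (f x)) where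
  memLp := h.memLp.star
  eq_integral x hx := by
    rw [h.eq_integral x hx, map_add, intervalIntegral.integral_of_le hx.1,
      intervalIntegral.integral_of_le hx.1, integral_conj]

lemma HasL2Deriv.integrable_mul {s : ℝ} {F f g : ℝ → ℂ} (hF : HasL2Deriv s F f)
    (hg : Integrable g (vol s)) : Integrable (fun x => g x * F x) (vol s) := by
  have h : IntegrableOn g (Set.Icc (s - 1 / 2) (s + 1 / 2)) := by
    rw [integrableOn_Icc_iff_integrableOn_Ioo]
    exact hg
  have h2 := h.mul_continuousOn hF.continuousOn isCompact_Icc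
  exact h2.mono_set Set.Ioo_subset_Icc_self

/-- Integration by parts. -/
lemma HasL2Deriv.parts {s : ℝ} {F f G g : ℝ → ℂ} (hF : HasL2Deriv s F f)
    (hG : HasL2Deriv s G g) :
    ∫ x, f x * G x ∂(vol s) + ∫ x, F x * g x ∂(vol s)
      = F (s + 1 / 2) * G (s + 1 / 2) - F (s - 1 / 2) * G (s - 1 / 2) := by
  have hmem : ∀ᵐ x ∂(vol s), x ∈ Set.Icc (s - 1 / 2) (s + 1 / 2) := by
    filter_upwards [ae_restrict_mem (μ := volume) measurableSet_Ioo] with x hx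
    exact Set.Ioo_subset_Icc_self hx
  have hf := hF.integrable
  have hg := hG.integrable
  have e1 : ∫ x, f x * (∫ t in Set.Iic x, g t ∂(vol s)) ∂(vol s)
      = ∫ x, f x * G x ∂(vol s) - (∫ x, f x ∂(vol s)) * G (s - 1 / 2) := by
    rw [← integral_mul_const, ← integral_sub (hG.integrable_mul hf) (hf.mul_const _)]
    refine integral_congr_ae ?_
    filter_upwards [hmem] with x hx
    rw [hG.eq_left_add x hx]
    ring
  have hFg : Integrable (fun x => F x * g x) (vol s) := by
    simpa only [mul_comm] using hF.integrable_mul hg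
  have e2 : ∫ x, (∫ t in Set.Iic x, f t ∂(vol s)) * g x ∂(vol s)
      = ∫ x, F x * g x ∂(vol s) - F (s - 1 / 2) * ∫ x, g x ∂(vol s) := by
    rw [← integral_const_mul, ← integral_sub hFg (hg.const_mul _)]
    refine integral_congr_ae ?_
    filter_upwards [hmem] with x hx
    rw [hF.eq_left_add x hx]
    ring
  have h := parts_aux hf hg
  rw [e1, e2] at h
  rw [hF.eq_right, hG.eq_right]
  linear_combination h

/-- `f ∈ L²` has absolutely continuous derivatives up to order `n - 1` and its `n`-th derivative
is in `L²` (`F k` is the `k`-th derivative of the continuous representative `F 0` of `f`);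
moreover the derivatives of order `< m` vanish at both end points. -/
structure IsTower (s : ℝ) (n m : ℕ) (f : L2 s) (F : ℕ → ℝ → ℂ) : Prop where
  ae_eq : f =ᵐ[vol s] F 0
  deriv : ∀ k < n, HasL2Deriv s (F k) (F (k + 1))
  left : ∀ j < m, F j (s - 1 / 2) = 0
  right : ∀ j < m, F j (s + 1 / 2) = 0

lemma IsTower.add {s : ℝ} {n m : ℕ} {f g : L2 s} {F G : ℕ → ℝ → ℂ} (hf : IsTower s n m f F)
    (hg : IsTower s n m g G) : IsTower s n m (f + g) (F + G) where
  ae_eq := (Lp.coeFn_add f g).trans (hf.ae_eq.add hg.ae_eq)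
  deriv k hk := (hf.deriv k hk).add (hg.deriv k hk)
  left j hj := by rw [Pi.add_apply, Pi.add_apply, hf.left j hj, hg.left j hj, add_zero]
  right j hj := by rw [Pi.add_apply, Pi.add_apply, hf.right j hj, hg.right j hj, add_zero]

lemma IsTower.smul {s : ℝ} {n m : ℕ} {f : L2 s} {F : ℕ → ℝ → ℂ} (c : ℂ)
    (hf : IsTower s n m f F) : IsTower s n m (c • f) (c • F) where
  ae_eq := (Lp.coeFn_smul c f).trans (hf.ae_eq.const_smul c)
  deriv k hk := (hf.deriv k hk).smul c
  left j hj := by rw [Pi.smul_apply, Pi.smul_apply, hf.left j hj, smul_zero]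
  right j hj := by rw [Pi.smul_apply, Pi.smul_apply, hf.right j hj, smul_zero]

lemma IsTower.ae_zero {s : ℝ} {n m : ℕ} {F : ℕ → ℝ → ℂ} (h : IsTower s n m 0 F) :
    ∀ k ≤ n, F k =ᵐ[vol s] 0 := by
  intro k
  induction k with
  | zero => exact fun _ => h.ae_eq.symm.trans (Lp.coeFn_zero _ _ _)
  | succ k ih =>
    intro hk
    have hd := h.deriv k (by omega)
    exact hd.ae_zero (hd.zero_of_ae (ih (by omega)))

lemma IsTower.memLp {s : ℝ} {n m : ℕ} {f : L2 s} {F : ℕ → ℝ → ℂ} (h : IsTower s n m f F) :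
    ∀ k ≤ n, MemLp (F k) 2 (vol s)
  | 0, _ => (memLp_congr_ae h.ae_eq).1 (Lp.memLp f)
  | k + 1, hk => (h.deriv k (by omega)).memLp

/-- The Sobolev space of `f ∈ Hⁿ(s - 1/2, s + 1/2)` whose derivatives of order `< m` vanish at
both end points. -/
def sob (s : ℝ) (n m : ℕ) : Submodule ℂ (L2 s) where
  carrier := {f | ∃ F, IsTower s n m f F}
  add_mem' := fun ⟨F, hF⟩ ⟨G, hG⟩ => ⟨F + G, hF.add hG⟩
  zero_mem' := ⟨0, ⟨Lp.coeFn_zero _ _ _,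
    fun _ _ => ⟨MemLp.zero, fun _ _ => by simp⟩, fun _ _ => rfl, fun _ _ => rfl⟩⟩
  smul_mem' := fun c _ ⟨F, hF⟩ => ⟨c • F, hF.smul c⟩

/-- The `k`-th weak derivative (`k ≤ n`) of an element of `sob s n m`, as an element of `L²`. -/
def weakD (s : ℝ) (n m k : ℕ) (hk : k ≤ n) : sob s n m →ₗ[ℂ] L2 s where
  toFun u := (u.2.choose_spec.memLp k hk).toLp (u.2.choose k)
  map_add' u v := by
    have h := ((u + v).2.choose_spec.add ((u.2.choose_spec.add v.2.choose_spec).smul (-1)))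
    have e : ((u + v : sob s n m) : L2 s) + (-1 : ℂ) • ((u : L2 s) + (v : L2 s)) = 0 := by
      simp only [Submodule.coe_add]
      module
    rw [e] at h
    rw [← MemLp.toLp_add]
    refine (MemLp.toLp_eq_toLp_iff _ _).2 ?_
    filter_upwards [h.ae_zero k hk] with x hx
    simp only [Pi.add_apply, Pi.smul_apply, Pi.zero_apply, smul_eq_mul] at hx ⊢
    linear_combination hx
  map_smul' c u := by
    have h := ((c • u).2.choose_spec.add ((u.2.choose_spec.smul c).smul (-1)))
    have e : ((c • u : sob s n m) : L2 s) + (-1 : ℂ) • (c • (u : L2 s)) = 0 := by simp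
    rw [e] at h
    rw [RingHom.id_apply, ← MemLp.toLp_const_smul]
    refine (MemLp.toLp_eq_toLp_iff _ _).2 ?_
    filter_upwards [h.ae_zero k hk] with x hx
    simp only [Pi.add_apply, Pi.smul_apply, Pi.zero_apply, smul_eq_mul] at hx ⊢
    linear_combination hx

lemma exists_tower {s : ℝ} {n m : ℕ} (u : sob s n m) :
    ∃ F, IsTower s n m u F ∧ ∀ k (hk : k ≤ n), weakD s n m k hk u =ᵐ[vol s] F k :=
  ⟨u.2.choose, u.2.choose_spec, fun k hk =>
    MemLp.coeFn_toLp (u.2.choose_spec.memLp k hk)⟩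

lemma weakD_zero {s : ℝ} {n m : ℕ} (u : sob s n m) :
    weakD s n m 0 (Nat.zero_le n) u = (u : L2 s) := by
  obtain ⟨F, hF, h⟩ := exists_tower u
  exact Lp.ext ((h 0 (Nat.zero_le n)).trans hF.ae_eq.symm)

lemma inner_parts {s : ℝ} {n m j k : ℕ} (u v : sob s n m) (hj : j + 1 ≤ n) (hk : k + 1 ≤ n)
    (h : j < m ∨ k < m) :
    ⟪weakD s n m (j + 1) hj u, weakD s n m k (by omega) v⟫_ℂ
      = -⟪weakD s n m j (by omega) u, weakD s n m (k + 1) hk v⟫_ℂ := by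
  obtain ⟨F, hF, hF'⟩ := exists_tower u
  obtain ⟨G, hG, hG'⟩ := exists_tower v
  have hp := (hF.deriv j hj).conj.parts (hG.deriv k hk)
  have e1 : ⟪weakD s n m (j + 1) hj u, weakD s n m k (by omega) v⟫_ℂ
      = ∫ x, conj (F (j + 1) x) * G k x ∂(vol s) := by
    rw [L2.inner_def]
    refine integral_congr_ae ?_
    filter_upwards [hF' (j + 1) hj, hG' k (by omega)] with x h1 h2
    rw [h1, h2, RCLike.inner_apply, mul_comm]
  have e2 : ⟪weakD s n m j (by omega) u, weakD s n m (k + 1) hk v⟫_ℂ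
      = ∫ x, conj (F j x) * G (k + 1) x ∂(vol s) := by
    rw [L2.inner_def]
    refine integral_congr_ae ?_
    filter_upwards [hF' j (by omega), hG' (k + 1) hk] with x h1 h2
    rw [h1, h2, RCLike.inner_apply, mul_comm]
  rw [e1, e2, eq_neg_iff_add_eq_zero, hp]
  rcases h with h | h
  · rw [hF.left j h, hF.right j h]
    simp
  · rw [hG.left k h, hG.right k h]
    simp

lemma eq_zero_of_weakD_one {s : ℝ} {n m : ℕ} (u : sob s n m) (hn : 1 ≤ n) (hm : 1 ≤ m)
    (h : weakD s n m 1 hn u = 0) : u = 0 := by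
  obtain ⟨F, hF, hF'⟩ := exists_tower u
  have h1 : F 1 =ᵐ[vol s] 0 := by
    refine (hF' 1 hn).symm.trans ?_
    rw [h]
    exact Lp.coeFn_zero _ _ _
  have hd := hF.deriv 0 hn
  refine Subtype.ext (Lp.ext ?_)
  refine hF.ae_eq.trans (Filter.EventuallyEq.trans ?_ (Lp.coeFn_zero _ _ _).symm)
  filter_upwards [ae_restrict_mem (μ := volume) measurableSet_Ioo] with x hx
  have hx' := Set.Ioo_subset_Icc_self hx
  rw [hd.eq_left_add x hx', hF.left 0 hm, integral_congr_ae (ae_restrict_of_ae h1)]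
  simp

/-- The domain of `A`: pairs `(W, Θ)` with `W ∈ H⁴`, `Θ ∈ H²` and `W = DW = Θ = 0` at both end
points. -/
def dom (s : ℝ) : Submodule ℂ (H s) :=
  (sob s 4 2).comap (WithLp.fstL 2 ℂ (L2 s) (L2 s)).toLinearMap ⊓
    (sob s 2 1).comap (WithLp.sndL 2 ℂ (L2 s) (L2 s)).toLinearMap

/-- The component `W` of an element of the domain. -/
def compW (s : ℝ) : dom s →ₗ[ℂ] sob s 4 2 where
  toFun w := ⟨(w : H s).fst, w.2.1⟩
  map_add' _ _ := rfl
  map_smul' _ _ := rfl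

/-- The component `Θ` of an element of the domain. -/
def compT (s : ℝ) : dom s →ₗ[ℂ] sob s 2 1 where
  toFun w := ⟨(w : H s).snd, w.2.2⟩
  map_add' _ _ := rfl
  map_smul' _ _ := rfl

/-- `(D² - a²)² W = D⁴ W - 2 a² D² W + a⁴ W`. -/
def fourthOp (a s : ℝ) : sob s 4 2 →ₗ[ℂ] L2 s :=
  weakD s 4 2 4 (by omega) - (2 * a ^ 2 : ℂ) • weakD s 4 2 2 (by omega)
    + (a ^ 4 : ℂ) • (sob s 4 2).subtype

/-- `(D² - a²) Θ`. -/
def secondOp (a s : ℝ) : sob s 2 1 →ₗ[ℂ] L2 s :=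
  weakD s 2 1 2 (by omega) - (a ^ 2 : ℂ) • (sob s 2 1).subtype

/-- `(W, Θ) ↦ ((D² - a²)² W, σ (D² - a²) Θ)` on the domain of `A`. -/
def diffOp (a s : ℝ) (σ : ℂ) : dom s →ₗ[ℂ] H s :=
  (WithLp.linearEquiv 2 ℂ (L2 s × L2 s)).symm.toLinearMap ∘ₗ
    ((fourthOp a s ∘ₗ compW s).prod (σ • (secondOp a s ∘ₗ compT s)))

/-- `diffOp` as an unbounded operator in `L²(s - 1/2, s + 1/2)²`. -/
def opA (a s : ℝ) (σ : ℂ) : H s →ₗ.[ℂ] H s := ⟨dom s, diffOp a s σ⟩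

lemma memLp_weight (N s : ℝ) (f : L2 s) :
    MemLp (fun x => ((N * (x - s) - 1 : ℝ) : ℂ) * f x) 2 (vol s) := by
  have h : MemLp (fun x : ℝ => ((N * (x - s) - 1 : ℝ) : ℂ)) ⊤ (vol s) := by
    refine memLp_top_of_bound (Continuous.aestronglyMeasurable (by fun_prop)) (|N| + 1) ?_
    filter_upwards [ae_restrict_mem (μ := volume) measurableSet_Ioo] with x hx
    rw [Complex.norm_real, Real.norm_eq_abs]
    have h1 : |x - s| ≤ 1 := abs_le.2 ⟨by linarith [hx.1], by linarith [hx.2]⟩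
    have h2 : |N * (x - s)| ≤ |N| := by
      rw [abs_mul]
      exact mul_le_of_le_one_right (abs_nonneg N) h1
    calc |N * (x - s) - 1| ≤ |N * (x - s)| + |1| := abs_sub _ _
      _ ≤ |N| + 1 := by rw [abs_one]; linarith
  exact (Lp.memLp f).mul' h

/-- Multiplication by `N (x - s) - 1` on `L²(s - 1/2, s + 1/2)`. -/
def weight (N s : ℝ) : L2 s →ₗ[ℂ] L2 s where
  toFun f := (memLp_weight N s f).toLp _
  map_add' f g := by
    rw [← MemLp.toLp_add]
    refine (MemLp.toLp_eq_toLp_iff _ _).2 ?_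
    filter_upwards [Lp.coeFn_add f g] with x hx
    simp only [hx, Pi.add_apply]
    ring
  map_smul' c f := by
    rw [RingHom.id_apply, ← MemLp.toLp_const_smul]
    refine (MemLp.toLp_eq_toLp_iff _ _).2 ?_
    filter_upwards [Lp.coeFn_smul c f] with x hx
    simp only [hx, Pi.smul_apply, smul_eq_mul]
    ring

/-- `(W, Θ) ↦ (Θ, d (N (x - s) - 1) W)`. -/
def couple (N s : ℝ) (d : ℂ) : H s →ₗ[ℂ] H s where
  toFun w := WithLp.toLp 2 (w.snd, d • weight N s w.fst)
  map_add' u v := by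
    rw [WithLp.add_fst, WithLp.add_snd, map_add, smul_add]
    rfl
  map_smul' c u := by
    rw [RingHom.id_apply, WithLp.smul_fst, WithLp.smul_snd, map_smul,
      smul_comm d c]
    rfl

/-- Green's formula for `diag ((D² - a²)², a² - D²)`. -/
lemma inner_diffOp (a s : ℝ) (u v : dom s) :
    ⟪diffOp a s (-1) u, (v : H s)⟫_ℂ =
      ⟪weakD s 4 2 2 (by omega) (compW s u), weakD s 4 2 2 (by omega) (compW s v)⟫_ℂ
      + 2 * a ^ 2 *
        ⟪weakD s 4 2 1 (by omega) (compW s u), weakD s 4 2 1 (by omega) (compW s v)⟫_ℂ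
      + a ^ 4 * ⟪(u : H s).fst, (v : H s).fst⟫_ℂ
      + ⟪weakD s 2 1 1 (by omega) (compT s u), weakD s 2 1 1 (by omega) (compT s v)⟫_ℂ
      + a ^ 2 * ⟪(u : H s).snd, (v : H s).snd⟫_ℂ := by
  have hW := weakD_zero (compW s v)
  have hT := weakD_zero (compT s v)
  have h1 := inner_parts (j := 3) (k := 0) (compW s u) (compW s v)
    (by omega) (by omega) (Or.inr (by omega))
  have h2 := inner_parts (j := 2) (k := 1) (compW s u) (compW s v)
    (by omega) (by omega) (Or.inr (by omega))
  have h3 := inner_parts (j := 1) (k := 0) (compW s u) (compW s v)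
    (by omega) (by omega) (Or.inr (by omega))
  have h4 := inner_parts (j := 1) (k := 0) (compT s u) (compT s v)
    (by omega) (by omega) (Or.inr (by omega))
  norm_num only at h1 h2 h3 h4
  rw [hW] at h1 h3
  rw [hT] at h4
  have e : ⟪diffOp a s (-1) u, (v : H s)⟫_ℂ
      = ⟪fourthOp a s (compW s u), (compW s v : L2 s)⟫_ℂ
        + ⟪(-1 : ℂ) • secondOp a s (compT s u), (compT s v : L2 s)⟫_ℂ := rfl
  rw [e]
  simp only [fourthOp, secondOp, LinearMap.add_apply, LinearMap.sub_apply, LinearMap.smul_apply,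
    Submodule.subtype_apply, inner_add_left, inner_sub_left, inner_smul_left, h1, h2, h3, h4]
  simp only [map_mul, map_pow, map_neg, map_one, Complex.conj_ofReal, map_ofNat]
  change _ = _ + a ^ 4 * ⟪(compW s u : L2 s), (compW s v : L2 s)⟫_ℂ + _
    + a ^ 2 * ⟪(compT s u : L2 s), (compT s v : L2 s)⟫_ℂ
  ring

lemma re_inner_diffOp (a s : ℝ) (u : dom s) :
    (⟪diffOp a s (-1) u, (u : H s)⟫_ℂ).re =
      ‖weakD s 4 2 2 (by omega) (compW s u)‖ ^ 2
      + 2 * a ^ 2 * ‖weakD s 4 2 1 (by omega) (compW s u)‖ ^ 2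
      + a ^ 4 * ‖(u : H s).fst‖ ^ 2
      + ‖weakD s 2 1 1 (by omega) (compT s u)‖ ^ 2
      + a ^ 2 * ‖(u : H s).snd‖ ^ 2 := by
  rw [inner_diffOp]
  simp only [inner_self_eq_norm_sq_to_K, Complex.coe_algebraMap]
  norm_cast

/-- The domain of `A`, to be normed by the energy norm. -/
def EnergyDomain (_a s : ℝ) : Type := dom s

instance (a s : ℝ) : AddCommGroup (EnergyDomain a s) := inferInstanceAs (AddCommGroup (dom s))

instance (a s : ℝ) : Module ℂ (EnergyDomain a s) := inferInstanceAs (Module ℂ (dom s))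

/-- The identity map from the domain of `A` to its copy that carries the energy norm. -/
def toEnergy (a s : ℝ) : dom s ≃ₗ[ℂ] EnergyDomain a s := LinearEquiv.refl ℂ (dom s)

/-- The energy inner product `(A u, v)`, with `A = diag ((D² - a²)², a² - D²)`. -/
@[reducible] def energyCore (a s : ℝ) : InnerProductSpace.Core ℂ (EnergyDomain a s) where
  inner u v := ⟪diffOp a s (-1) ((toEnergy a s).symm u), ((toEnergy a s).symm v : H s)⟫_ℂ
  conj_inner_symm u v := by
    simp only [inner_diffOp, map_add, map_mul, map_pow, Complex.conj_ofReal, map_ofNat,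
      inner_conj_symm]
  re_inner_nonneg u := by
    change 0 ≤ (⟪diffOp a s (-1) ((toEnergy a s).symm u), ((toEnergy a s).symm u : H s)⟫_ℂ).re
    rw [re_inner_diffOp]
    positivity
  add_left u v w := by rw [map_add, map_add, inner_add_left]
  smul_left u v c := by rw [map_smul, map_smul, inner_smul_left]
  definite u h := by
    have h0 := congrArg Complex.re h
    rw [re_inner_diffOp, Complex.zero_re] at h0
    set w := (toEnergy a s).symm u with hw
    have p1 := sq_nonneg ‖weakD s 4 2 2 (by omega) (compW s w)‖
    have p2 : 0 ≤ 2 * a ^ 2 * ‖weakD s 4 2 1 (by omega) (compW s w)‖ ^ 2 := by positivity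
    have p3 : 0 ≤ a ^ 4 * ‖(w : H s).fst‖ ^ 2 := by positivity
    have p4 := sq_nonneg ‖weakD s 2 1 1 (by omega) (compT s w)‖
    have p5 : 0 ≤ a ^ 2 * ‖(w : H s).snd‖ ^ 2 := by positivity
    have q1 : weakD s 4 2 2 (by omega) (compW s w) = 0 := by
      rw [← norm_eq_zero, ← sq_eq_zero_iff]; linarith
    have q4 : weakD s 2 1 1 (by omega) (compT s w) = 0 := by
      rw [← norm_eq_zero, ← sq_eq_zero_iff]; linarith
    have r := inner_parts (j := 1) (k := 0) (compW s w) (compW s w)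
      (by omega) (by omega) (Or.inr (by omega))
    norm_num only at r
    rw [q1, inner_zero_left, zero_eq_neg, inner_self_eq_zero] at r
    have hW := eq_zero_of_weakD_one (compW s w) (by omega) (by omega) r
    have hT := eq_zero_of_weakD_one (compT s w) (by omega) (by omega) q4
    have hw0 : w = 0 := by
      refine Subtype.ext (WithLp.ofLp_injective 2 (Prod.ext ?_ ?_))
      · exact congrArg Subtype.val hW
      · exact congrArg Subtype.val hT
    rw [hw] at hw0
    simpa using hw0

instance (a s : ℝ) : NormedAddCommGroup (EnergyDomain a s) :=
  (energyCore a s).toNormedAddCommGroup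

instance (a s : ℝ) : InnerProductSpace ℂ (EnergyDomain a s) :=
  InnerProductSpace.ofCore (energyCore a s).toCore

/-- The energy norm `(A w, w)^(1/2)`. -/
def energyNorm (a s : ℝ) (w : dom s) : ℝ := ‖toEnergy a s w‖

/-- The Hilbert space `H₀`: the completion of the domain of `A` in the energy norm. -/
abbrev H0 (a s : ℝ) : Type := UniformSpace.Completion (EnergyDomain a s)

/-- The canonical embedding of the domain of `A` into `H₀`. -/
def toH0 (a s : ℝ) (w : dom s) : H0 a s := (toEnergy a s w : EnergyDomain a s)

/-- Finite-dimensional trial spaces in the domain of `A` that are complete in `H₀`: every element of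
the domain (which is dense in `H₀`) is approximated in the energy norm. -/
structure IsTrialFamily (a s : ℝ) (X : ℕ → Submodule ℂ (dom s)) : Prop where
  finite : ∀ n, FiniteDimensional ℂ (X n)
  complete : ∀ u : dom s, ∀ ε > 0, ∃ n₀, ∀ n ≥ n₀, ∃ v ∈ X n, energyNorm a s (u - v) < ε

/-- `X = V × T`: the two unknowns `W`, `Θ` are expanded separately. -/
def IsProductSpace {s : ℝ} (X : Submodule ℂ (dom s)) : Prop :=
  ∃ V T : Submodule ℂ (L2 s), ∀ w : dom s, w ∈ X ↔ (w : H s).fst ∈ V ∧ (w : H s).snd ∈ T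

/-- `w` is an eigenvector, for the parameter value `μ`, of the problem `A w = B(μ) w`. -/
def IsEigenpair {s : ℝ} (A : dom s →ₗ[ℂ] H s) (B : ℂ → H s →ₗ[ℂ] H s) (μ : ℂ) (w : dom s) : Prop :=
  w ≠ 0 ∧ A w = B μ w

/-- `w ∈ X` is a Galerkin eigenvector, with Galerkin eigenvalue `μ`, of the problem `A w = B(μ) w`:
the residual is `L²`-orthogonal to the trial space. -/
def IsGalerkinEigenpair {s : ℝ} (A : dom s →ₗ[ℂ] H s) (B : ℂ → H s →ₗ[ℂ] H s)
    (X : Submodule ℂ (dom s)) (μ : ℂ) (w : dom s) : Prop :=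
  w ≠ 0 ∧ w ∈ X ∧ ∀ v ∈ X, ⟪(v : H s), A w - B μ w⟫_ℂ = 0

/-- Convergence of the Galerkin method for `A w = B(μ) w` on the trial spaces `X n`. -/
structure GalerkinConverges (a : ℝ) {s : ℝ} (A : dom s →ₗ[ℂ] H s) (B : ℂ → H s →ₗ[ℂ] H s)
    (X : ℕ → Submodule ℂ (dom s)) : Prop where
  /-- Every eigenvalue is a limit of Galerkin eigenvalues. -/
  approximated : ∀ μ w, IsEigenpair A B μ w → ∃ m : ℕ → ℂ,
    (∀ᶠ n in Filter.atTop, ∃ v, IsGalerkinEigenpair A B (X n) (m n) v) ∧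
      Filter.Tendsto m Filter.atTop (nhds μ)
  /-- Every limit of Galerkin eigenvalues along a subsequence is an eigenvalue. -/
  no_spurious : ∀ (φ : ℕ → ℕ) (m : ℕ → ℂ) (v : ℕ → dom s) (μ : ℂ),
    Filter.Tendsto φ Filter.atTop Filter.atTop →
    (∀ k, IsGalerkinEigenpair A B (X (φ k)) (m k) (v k)) →
    Filter.Tendsto m Filter.atTop (nhds μ) → ∃ w, IsEigenpair A B μ w
  /-- The corresponding Galerkin eigenvectors converge to exact eigenvectors, with relative error
  tending to zero both in the norm of `H₀` and in that of `L²`. -/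
  eigenvectors : ∀ (φ : ℕ → ℕ) (m : ℕ → ℂ) (v : ℕ → dom s) (μ : ℂ),
    Filter.Tendsto φ Filter.atTop Filter.atTop →
    (∀ k, IsGalerkinEigenpair A B (X (φ k)) (m k) (v k)) →
    Filter.Tendsto m Filter.atTop (nhds μ) →
    ∃ w : ℕ → dom s, (∀ᶠ k in Filter.atTop, IsEigenpair A B μ (w k)) ∧
      Filter.Tendsto (fun k => energyNorm a s (v k - w k) / energyNorm a s (v k))
        Filter.atTop (nhds 0) ∧
      Filter.Tendsto (fun k => ‖((v k - w k : dom s) : H s)‖ / ‖(v k : H s)‖)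
        Filter.atTop (nhds 0)

end Convection

end

open Convection
open scoped InnerProductSpace

/-!
Inverting `A₊ = diag ((D² - a²)², a² - D²)` turns `A₊ w = B(μ) w` into the fixed point equation
`w = T(μ) w` in the energy space `H₀`, where `T(μ) = A₊⁻¹ B(μ)` is compact, and turns the Galerkin
equation on `X n` into `w = P n T(μ) w`, where `P n` is the `H₀`-orthogonal projection onto `X n`.
Everything follows from the compactness of `T(μ)` and from `P n → 1` strongly.

*The inverse.* The solution operators of `D⁴ W = f` with clamped ends and of `D² Θ = f` with
Dirichlet conditions (`clamped`, `dirichlet`) are powers of the Volterra operator, corrected by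
operators of finite rank; the Volterra operator is compact as a norm limit of operators of finite
rank (`isCompactOperator_volterra`). The lower order terms make `(D² - a²)²` and `D² - a²`, composed with these, into compact perturbations of the
identity, which are injective by Green's formula and hence invertible by the Fredholm alternative
(`exists_compact_solution`). So `A₊` is onto, with compact inverse; together with symmetry and
coercivity this gives density of the domain and self-adjointness. The map `A₊⁻¹ : L² → H₀` (`green`)
has the inclusion `H₀ → L²` (`incl`) as its adjoint, so the composite `A₊⁻¹ : L² → L²` is
`green* ∘ green`, and `green` inherits its compactness (`IsCompactOperator.of_adjoint_comp_self`).

*Convergence.* Normalized approximate solutions of the Galerkin equation approach the fixed space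
of `T(μ)` (`exists_fixed_near`): this shows that limits of Galerkin eigenvalues are eigenvalues and
that the Galerkin eigenvectors converge in `H₀`; in `L²` they converge because `T(μ)` factors
through `L²`, so that both norms are comparable on an eigenspace. Conversely, the eigenvalues are
countable, so every eigenvalue `μ` is the centre of arbitrarily small circles free of eigenvalues.
If infinitely many of the discretized problems had no eigenvalue in such a disc, their resolvents
would be holomorphic there, and the maximum principle would carry their blow-up from `μ` to the
circle, which `exists_fixed_near` excludes (`exists_galerkin_eigenvalue_near`).

*The other two forms.* If `W` and `Θ` are expanded separately, the trial spaces are invariant under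
`(W, Θ) ↦ (W, -Θ)`, and this reflection maps the problem for `A` to that for `A₊`. The system with
eigenvalue `R` is covered by the same theorem, with an affine function `B(R)`; its eigenvalues are
countable because `R = λ² / a²` for an eigenvalue `λ` of `A w = λ K w`.
-/

open Filter Topology

noncomputable section

/-! ### Compact operators on Hilbert spaces and their Galerkin approximation -/

section Abstract

/-- Since `‖G x‖² ≤ ‖G* G x‖ ‖x‖`, a finite net for the image of the unit ball under `G* G` yields
one for its image under `G`. -/
theorem IsCompactOperator.of_adjoint_comp_self {E F : Type*} [NormedAddCommGroup E]
    [InnerProductSpace ℂ E] [CompleteSpace E] [NormedAddCommGroup F] [InnerProductSpace ℂ F]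
    [CompleteSpace F] {G : E →L[ℂ] F}
    (h : IsCompactOperator (ContinuousLinearMap.adjoint G ∘L G)) : IsCompactOperator G := by
  refine (isCompactOperator_iff_isCompact_closure_image_closedBall (G : E →ₗ[ℂ] F) one_pos).2 ?_
  have hK := IsCompactOperator.isCompact_closure_image_closedBall
    (f := ((ContinuousLinearMap.adjoint G ∘L G : E →L[ℂ] E) : E →ₗ[ℂ] E)) h 1
  have htb := hK.totallyBounded.subset subset_closure
  refine (TotallyBounded.closure ?_).isCompact_of_isClosed isClosed_closure
  refine Metric.totallyBounded_iff.2 fun ε hε => ?_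
  obtain ⟨t, htB, htf, ht⟩ := htb.exists_subset (Metric.dist_mem_uniformity
    (show (0 : ℝ) < ε ^ 2 / 2 by positivity))
  have htB' : ∀ z ∈ t, ∃ x ∈ Metric.closedBall (0 : E) 1,
      ContinuousLinearMap.adjoint G (G x) = z := fun z hz => htB hz
  choose! p hp hpt using htB'
  refine ⟨(fun z => G (p z)) '' t, htf.image _, ?_⟩
  rintro _ ⟨x, hx, rfl⟩
  obtain ⟨z, hz, hxz⟩ := Set.mem_iUnion₂.1 (ht ⟨x, hx, rfl⟩)
  refine Set.mem_iUnion₂.2 ⟨G (p z), ⟨z, hz, rfl⟩, ?_⟩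
  have hxz' : ‖ContinuousLinearMap.adjoint G (G (x - p z))‖ < ε ^ 2 / 2 := by
    have h1 : dist (ContinuousLinearMap.adjoint G (G x)) z < ε ^ 2 / 2 := hxz
    have h2 : ContinuousLinearMap.adjoint G (G (p z)) = z := hpt z hz
    rwa [← h2, dist_eq_norm, ← map_sub, ← map_sub] at h1
  have hd : ‖x - p z‖ ≤ 2 := by
    have h1 := mem_closedBall_zero_iff.1 hx
    have h2 := mem_closedBall_zero_iff.1 (hp z hz)
    exact (norm_sub_le _ _).trans (by linarith)
  rw [Metric.mem_ball, dist_eq_norm]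
  change ‖G x - G (p z)‖ < ε
  rw [← map_sub]
  refine lt_of_pow_lt_pow_left₀ 2 hε.le ?_
  have h3 := ContinuousLinearMap.apply_norm_sq_eq_inner_adjoint_left G (x - p z)
  rw [h3]
  calc _ ≤ ‖ContinuousLinearMap.adjoint G (G (x - p z))‖ * ‖x - p z‖ :=
        (RCLike.re_le_norm _).trans (norm_inner_le_norm _ _)
    _ ≤ ‖ContinuousLinearMap.adjoint G (G (x - p z))‖ * 2 := by gcongr
    _ < ε ^ 2 := by linarith

/-- A densely defined symmetric operator that is onto is self-adjoint. -/
theorem LinearPMap.isSelfAdjoint_of_surjective {E : Type*} [NormedAddCommGroup E]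
    [InnerProductSpace ℂ E] [CompleteSpace E] {A : E →ₗ.[ℂ] E} (hd : Dense (A.domain : Set E))
    (hA : A.IsFormalAdjoint A) (hs : ∀ f, ∃ x : A.domain, A x = f) : IsSelfAdjoint A := by
  rw [LinearPMap.isSelfAdjoint_def]
  refine le_antisymm ?_ (LinearPMap.IsFormalAdjoint.le_adjoint hd hA)
  have key : ∀ y : A.adjoint.domain, ∃ x : A.domain, (x : E) = y ∧ A x = A.adjoint y := by
    intro y
    obtain ⟨x, hx⟩ := hs (A.adjoint y)
    refine ⟨x, ?_, hx⟩
    obtain ⟨z, hz⟩ := hs ((x : E) - y)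
    have h1 := LinearPMap.adjoint_isFormalAdjoint hd y z
    have h2 := hA x z
    rw [← hx, h2, hz, ← sub_eq_zero, ← inner_sub_left, inner_self_eq_zero, sub_eq_zero] at h1
    exact h1
  refine ⟨fun y hy => ?_, fun y x hyx => ?_⟩
  · obtain ⟨x, hx, -⟩ := key ⟨y, hy⟩
    exact (show (x : E) = y from hx) ▸ x.2
  · obtain ⟨x', hx', hAx'⟩ := key y
    rw [← hAx']
    exact congrArg A (Subtype.ext (hx'.trans hyx))

variable {E : Type*} [NormedAddCommGroup E] [InnerProductSpace ℂ E]

/-- Orthogonal projections onto subspaces that approximate a dense set converge strongly to the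
identity. -/
theorem tendsto_starProjection_of_forall_near {Y : ℕ → Submodule ℂ E}
    [∀ n, (Y n).HasOrthogonalProjection] {S : Set E} (hS : Dense S)
    (h : ∀ u ∈ S, ∀ ε > 0, ∀ᶠ n in atTop, ∃ v ∈ Y n, ‖u - v‖ < ε) (u : E) :
    Tendsto (fun n => (Y n).starProjection u) atTop (𝓝 u) := by
  rw [Metric.tendsto_nhds]
  intro ε hε
  obtain ⟨x, hxS, hx⟩ := Metric.dense_iff.1 hS u (ε / 2) (by positivity)
  filter_upwards [h x hx (ε / 2) (by positivity)] with n hn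
  obtain ⟨v, hv, hvx⟩ := hn
  rw [dist_comm, dist_eq_norm, Submodule.starProjection_minimal]
  refine (ciInf_le ⟨0, ?_⟩ (⟨v, hv⟩ : Y n)).trans_lt ?_
  · rintro _ ⟨y, rfl⟩
    exact norm_nonneg _
  · have h1 : ‖u - x‖ < ε / 2 := by
      rw [← dist_eq_norm, dist_comm]; exact hxS
    calc ‖u - v‖ ≤ ‖u - x‖ + ‖x - v‖ := norm_sub_le_norm_sub_add_norm_sub _ _ _
      _ < ε := by linarith

/-- Approximate solutions `u k` of the Galerkin equation `u = P T(m k) u` are close to fixed points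
of `T(μ)` if `m k → μ`: compactness turns `T(μ) u k` into a convergent sequence, along subsequences,
and `u k` has the same limit. -/
theorem exists_fixed_near {Y : ℕ → Submodule ℂ E} [∀ n, (Y n).HasOrthogonalProjection]
    (hY : ∀ u, Tendsto (fun n => (Y n).starProjection u) atTop (𝓝 u))
    {T : ℂ → E →L[ℂ] E} {μ : ℂ} (hT : ContinuousAt T μ) (hc : IsCompactOperator (T μ))
    {φ : ℕ → ℕ} (hφ : Tendsto φ atTop atTop) {m : ℕ → ℂ} (hm : Tendsto m atTop (𝓝 μ))
    {u : ℕ → E} (hu : ∀ k, ‖u k‖ ≤ 1)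
    (h : Tendsto (fun k => u k - (Y (φ k)).starProjection (T (m k) (u k))) atTop (𝓝 0)) :
    ∃ w : ℕ → E, (∀ k, T μ (w k) = w k) ∧ Tendsto (fun k => u k - w k) atTop (𝓝 0) := by
  have hTm : Tendsto (fun k => ‖T (m k) - T μ‖) atTop (𝓝 0) := by
    have := (hT.tendsto.comp hm).sub_const (T μ)
    rw [sub_self] at this
    simpa using this.norm
  have h1 : Tendsto (fun k => u k - (Y (φ k)).starProjection (T μ (u k))) atTop (𝓝 0) := by
    have h2 : Tendsto (fun k => (Y (φ k)).starProjection ((T (m k) - T μ) (u k))) atTop (𝓝 0) := by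
      refine squeeze_zero_norm (fun k => ?_) hTm
      calc ‖(Y (φ k)).starProjection ((T (m k) - T μ) (u k))‖ ≤ ‖(T (m k) - T μ) (u k)‖ :=
            Submodule.norm_starProjection_apply_le _ _
        _ ≤ ‖T (m k) - T μ‖ * ‖u k‖ := ContinuousLinearMap.le_opNorm _ _
        _ ≤ ‖T (m k) - T μ‖ := mul_le_of_le_one_right (norm_nonneg _) (hu k)
    simpa using h.add h2
  set N : Set E := {v | T μ v = v} with hN
  have hne : N.Nonempty := ⟨0, by simp [hN]⟩
  have hinf : Tendsto (fun k => Metric.infDist (u k) N) atTop (𝓝 0) := by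
    refine tendsto_of_subseq_tendsto fun ns hns => ?_
    obtain ⟨K, hK, hK'⟩ := hc.image_closedBall_subset_compact 1
    obtain ⟨y, -, ψ, hψ, hy⟩ := hK.tendsto_subseq (x := fun k => T μ (u (ns k)))
      fun k => hK' ⟨u (ns k), by simp [hu], rfl⟩
    refine ⟨ψ, ?_⟩
    have hs : Tendsto (fun k => ns (ψ k)) atTop atTop := hns.comp hψ.tendsto_atTop
    have hPy : Tendsto (fun k => (Y (φ (ns (ψ k)))).starProjection y) atTop (𝓝 y) :=
      (hY y).comp (hφ.comp hs)
    have hPT : Tendsto (fun k => (Y (φ (ns (ψ k)))).starProjection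
        (T μ (u (ns (ψ k))) - y)) atTop (𝓝 0) := by
      have hz : Tendsto (fun k => ‖T μ (u (ns (ψ k))) - y‖) atTop (𝓝 0) := by
        have := hy.sub_const y
        rw [sub_self] at this
        simpa using this.norm
      exact squeeze_zero_norm (fun k => Submodule.norm_starProjection_apply_le _ _) hz
    have huy : Tendsto (fun k => u (ns (ψ k))) atTop (𝓝 y) := by
      have := ((h1.comp hs).add hPT).add hPy
      simpa using this
    have hyN : y ∈ N := tendsto_nhds_unique (((T μ).continuous.tendsto y).comp huy) hy
    have hd : Tendsto (fun k => dist (u (ns (ψ k))) y) atTop (𝓝 0) :=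
      tendsto_iff_dist_tendsto_zero.1 huy
    exact squeeze_zero (fun _ => Metric.infDist_nonneg)
      (fun k => Metric.infDist_le_dist_of_mem hyN) hd
  have hex : ∀ k, ∃ w ∈ N, dist (u k) w < Metric.infDist (u k) N + 1 / ((k : ℝ) + 1) := fun k =>
    (Metric.infDist_lt_iff hne).1 (lt_add_of_pos_right _ Nat.one_div_pos_of_nat)
  choose w hwN hw using hex
  have hlim := hinf.add (tendsto_one_div_add_atTop_nhds_zero_nat (𝕜 := ℝ))
  rw [add_zero] at hlim
  refine ⟨w, hwN, squeeze_zero_norm (fun k => ?_) hlim⟩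
  rw [← dist_eq_norm]
  exact (hw k).le

/-- Orthonormalizing eigenvectors of distinct eigenvalues `l n` gives an orthonormal sequence `e`
with `⟪e n, T (e n)⟫ = l n`, and this inner product tends to zero along a subsequence. -/
theorem IsCompactOperator.finite_setOf_eigenvalue_ge {T : E →L[ℂ] E} (hT : IsCompactOperator T)
    {ε : ℝ} (hε : 0 < ε) :
    {z : ℂ | ε ≤ ‖z‖ ∧ ∃ v : E, v ≠ 0 ∧ T v = z • v}.Finite := by
  by_contra hinf
  set S := {z : ℂ | ε ≤ ‖z‖ ∧ ∃ v : E, v ≠ 0 ∧ T v = z • v} with hS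
  obtain ⟨l, hl⟩ : ∃ l : ℕ → ℂ, Function.Injective l ∧ ∀ n, l n ∈ S := by
    have := Set.Infinite.natEmbedding S hinf
    exact ⟨fun n => this n, fun a b hab => this.injective (Subtype.ext hab), fun n => (this n).2⟩
  obtain ⟨hinj, hl⟩ := hl
  choose x hx0 hx using fun n => (hl n).2
  have hli : LinearIndependent ℂ x := by
    refine Module.End.eigenvectors_linearIndependent' (T : Module.End ℂ E) l hinj x fun n => ?_
    exact ⟨Module.End.mem_eigenspace_iff.2 (hx n), hx0 n⟩
  set e := InnerProductSpace.gramSchmidtNormed ℂ x with he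
  have hon : Orthonormal ℂ e := InnerProductSpace.gramSchmidtNormed_orthonormal hli
  have key : ∀ n, ⟪e n, T (e n)⟫_ℂ = l n := by
    intro n
    set p := Submodule.span ℂ (x '' Set.Iio n) with hp
    -- `T` preserves the span of the earlier eigenvectors, and acts on `e n` as `l n` modulo it
    have hinv : ∀ y ∈ p, T y ∈ p := by
      intro y hy
      have : p ≤ p.comap (T : E →ₗ[ℂ] E) := by
        refine Submodule.span_le.2 ?_
        rintro _ ⟨i, hi, rfl⟩
        change T (x i) ∈ p
        rw [hx i]
        exact p.smul_mem _ (Submodule.subset_span ⟨i, hi, rfl⟩)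
      exact this hy
    set g := InnerProductSpace.gramSchmidt ℂ x n with hg
    have hgx : x n - g ∈ p := by
      have := InnerProductSpace.gramSchmidt_def' ℂ x n
      have h2 : x n - g = ∑ i ∈ Finset.Iio n,
          (ℂ ∙ InnerProductSpace.gramSchmidt ℂ x i).starProjection (x n) := by
        rw [sub_eq_iff_eq_add', ← this]
      rw [h2]
      refine Submodule.sum_mem _ fun i hi => ?_
      rw [hp, ← InnerProductSpace.span_gramSchmidt_Iio ℂ x n]
      have h3 := Submodule.starProjection_apply_mem (ℂ ∙ InnerProductSpace.gramSchmidt ℂ x i) (x n)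
      refine Submodule.span_mono ?_ h3
      rintro _ rfl
      exact ⟨i, by simpa using hi, rfl⟩
    have horth : ∀ y ∈ p, ⟪g, y⟫_ℂ = 0 := by
      intro y hy
      rw [hp, ← InnerProductSpace.span_gramSchmidt_Iio ℂ x n] at hy
      have : Submodule.span ℂ (InnerProductSpace.gramSchmidt ℂ x '' Set.Iio n) ≤ (ℂ ∙ g)ᗮ := by
        refine Submodule.span_le.2 ?_
        rintro _ ⟨i, hi, rfl⟩
        exact Submodule.mem_orthogonal_singleton_iff_inner_right.2
          (InnerProductSpace.gramSchmidt_orthogonal ℂ x (ne_of_gt hi))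
      exact Submodule.mem_orthogonal_singleton_iff_inner_right.1 (this hy)
    have hTg : T g - l n • g ∈ p := by
      have : T g - l n • g = l n • (x n - g) - T (x n - g) := by
        rw [map_sub, hx n]; module
      rw [this]
      exact p.sub_mem (p.smul_mem _ hgx) (hinv _ hgx)
    have hen : e n = ((‖g‖ : ℂ)⁻¹) • g := rfl
    have h0 : ⟪e n, T (e n) - l n • e n⟫_ℂ = 0 := by
      have : T (e n) - l n • e n = ((‖g‖ : ℂ)⁻¹) • (T g - l n • g) := by
        rw [hen, map_smul]; module
      rw [this, hen, inner_smul_left, inner_smul_right, horth _ hTg, mul_zero, mul_zero]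
    rw [inner_sub_right, inner_smul_right, inner_self_eq_norm_sq_to_K, hon.1 n] at h0
    simpa [sub_eq_zero] using h0
  obtain ⟨K, hK, hK'⟩ := hT.image_closedBall_subset_compact 1
  obtain ⟨y, -, ψ, hψ, hy⟩ := hK.tendsto_subseq (x := fun k => T (e k))
    fun k => hK' ⟨e k, by simp [hon.1 k], rfl⟩
  have hb : Tendsto (fun k => ‖⟪e k, y⟫_ℂ‖) atTop (𝓝 0) := by
    have := (hon.inner_products_summable y).tendsto_atTop_zero.sqrt
    simpa using this
  have hz : Tendsto (fun k => ‖⟪e (ψ k), y⟫_ℂ‖ + ‖T (e (ψ k)) - y‖) atTop (𝓝 0) := by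
    have h2 := hy.sub_const y
    rw [sub_self] at h2
    simpa using (hb.comp hψ.tendsto_atTop).add h2.norm
  refine absurd (ge_of_tendsto' hz fun k => ?_) (not_le.2 hε)
  calc ε ≤ ‖l (ψ k)‖ := (hl (ψ k)).1
    _ = ‖⟪e (ψ k), y⟫_ℂ + ⟪e (ψ k), T (e (ψ k)) - y⟫_ℂ‖ := by
      rw [← inner_add_right, add_sub_cancel, key]
    _ ≤ _ := by
      refine (norm_add_le _ _).trans (add_le_add_right ?_ _)
      refine (norm_inner_le_norm _ _).trans ?_
      rw [hon.1, one_mul]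

theorem IsCompactOperator.countable_setOf_eigenvalue {T : E →L[ℂ] E} (hT : IsCompactOperator T) :
    {z : ℂ | z ≠ 0 ∧ ∃ v : E, v ≠ 0 ∧ T v = z • v}.Countable := by
  refine (Set.countable_iUnion fun n : ℕ =>
    (hT.finite_setOf_eigenvalue_ge (Nat.one_div_pos_of_nat (α := ℝ) (n := n))).countable).mono ?_
  rintro z ⟨hz, hv⟩
  obtain ⟨n, hn⟩ := exists_nat_one_div_lt (norm_pos_iff.2 hz)
  exact Set.mem_iUnion.2 ⟨n, hn.le, hv⟩

/-- If every neighbourhood of `μ` eventually meets `S n`, then `μ` is a limit of points of the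
`S n`: nearly closest points will do. -/
theorem exists_seq_tendsto_of_forall_eventually {S : ℕ → Set ℂ} {μ : ℂ}
    (h : ∀ ε > 0, ∀ᶠ n in atTop, ∃ z ∈ S n, dist z μ < ε) :
    ∃ m : ℕ → ℂ, (∀ᶠ n in atTop, m n ∈ S n) ∧ Tendsto m atTop (𝓝 μ) := by
  have hex : ∀ n, ∃ z, (S n).Nonempty →
      z ∈ S n ∧ dist μ z < Metric.infDist μ (S n) + 1 / ((n : ℝ) + 1) := by
    intro n
    by_cases hn : (S n).Nonempty
    · obtain ⟨z, hz, hd⟩ := (Metric.infDist_lt_iff (x := μ) hn).1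
        (lt_add_of_pos_right _ (Nat.one_div_pos_of_nat (α := ℝ) (n := n)))
      exact ⟨z, fun _ => ⟨hz, hd⟩⟩
    · exact ⟨0, fun h => absurd h hn⟩
  choose m hm using hex
  refine ⟨m, ?_, Metric.tendsto_nhds.2 fun ε hε => ?_⟩
  · filter_upwards [h 1 one_pos] with n ⟨z, hz, _⟩
    exact (hm n ⟨z, hz⟩).1
  · filter_upwards [h (ε / 2) (by positivity),
      (tendsto_one_div_add_atTop_nhds_zero_nat (𝕜 := ℝ)).eventually_lt_const
        (show (0 : ℝ) < ε / 2 by positivity)] with n ⟨z, hz, hd⟩ hn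
    have h1 := (hm n ⟨z, hz⟩).2
    have h2 := Metric.infDist_le_dist_of_mem (x := μ) hz
    rw [dist_comm] at hd ⊢
    linarith

variable [CompleteSpace E]

theorem IsCompactOperator.isUnit_one_sub {T : E →L[ℂ] E} (hT : IsCompactOperator T)
    (h : ∀ v, T v = v → v = 0) : IsUnit (1 - T) := by
  rcases hT.hasEigenvalue_or_mem_resolventSet one_ne_zero with h1 | h1
  · obtain ⟨v, hv⟩ := h1.exists_hasEigenvector
    exact absurd (h v (by simpa using hv.apply_eq_smul)) hv.2
  · simpa [spectrum.mem_resolventSet_iff] using h1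

/-- An eigenvalue of an analytic family of compact operators is approximated by Galerkin
eigenvalues. -/
theorem exists_galerkin_eigenvalue_near {Y : ℕ → Submodule ℂ E}
    [∀ n, (Y n).HasOrthogonalProjection]
    (hY : ∀ u, Tendsto (fun n => (Y n).starProjection u) atTop (𝓝 u))
    {T : ℂ → E →L[ℂ] E} (hT : Differentiable ℂ T) (hc : ∀ z, IsCompactOperator (T z))
    (hcount : {z | ∃ v, v ≠ 0 ∧ T z v = v}.Countable) {μ : ℂ} {w : E} (hw : w ≠ 0)
    (hμ : T μ w = w) {ε : ℝ} (hε : 0 < ε) :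
    ∀ᶠ n in atTop, ∃ z, dist z μ < ε ∧ ∃ v, v ≠ 0 ∧ (Y n).starProjection (T z v) = v := by
  -- a circle around `μ`, of radius less than `ε`, free of eigenvalues
  obtain ⟨r, hr, hr0, hrε⟩ : ∃ r, r ∉ (fun z => dist z μ) '' {z | ∃ v, v ≠ 0 ∧ T z v = v} ∧
      0 < r ∧ r < ε := by
    obtain ⟨r, hr, hr2⟩ := ((hcount.image fun z => dist z μ).dense_compl ℝ).exists_between hε
    exact ⟨r, hr, hr2⟩
  by_contra hcon
  obtain ⟨φ, hφ, hno⟩ := extraction_of_frequently_atTop (not_eventually.1 hcon)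
  -- the operators `1 - P T(z)` are invertible for `z` in the closed disc of radius `r`
  set A : ℕ → ℂ → E →L[ℂ] E := fun k z => 1 - (Y (φ k)).starProjection ∘L T z with hA
  have hAapp : ∀ k z v, A k z v = v - (Y (φ k)).starProjection (T z v) := fun k z v => rfl
  have hunit : ∀ k, ∀ z ∈ Metric.closedBall μ r, IsUnit (A k z) := by
    intro k z hz
    refine ((hc z).clm_comp (Y (φ k)).starProjection).isUnit_one_sub fun v hv => ?_
    by_contra hv0
    exact hno k ⟨z, (Metric.mem_closedBall.1 hz).trans_lt hrε, v, hv0, hv⟩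
  -- the residual of the exact eigenvector at `μ` tends to zero
  set x : ℕ → E := fun k => A k μ w with hx
  have hx0 : Tendsto x atTop (𝓝 0) := by
    have h1 := ((hY w).comp hφ.tendsto_atTop).const_sub w
    rw [sub_self] at h1
    refine h1.congr fun k => ?_
    rw [hx, Function.comp_apply]
    simp only [hAapp, hμ]
  -- `f k = (1 - P T(·))⁻¹ (x k)` is holomorphic and takes the value `w` at the centre, so by the
  -- maximum principle it is at least as large somewhere on the circle
  set f : ℕ → ℂ → E := fun k z => Ring.inverse (A k z) (x k) with hf
  have hAf : ∀ k, ∀ z ∈ Metric.closedBall μ r, A k z (f k z) = x k := by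
    intro k z hz
    have := Ring.mul_inverse_cancel _ (hunit k z hz)
    exact congrArg (fun B : E →L[ℂ] E => B (x k)) this
  have hfμ : ∀ k, f k μ = w := by
    intro k
    have := Ring.inverse_mul_cancel _ (hunit k μ (Metric.mem_closedBall_self hr0.le))
    exact congrArg (fun B : E →L[ℂ] E => B w) this
  have hdiff : ∀ k, DiffContOnCl ℂ (f k) (Metric.ball μ r) := by
    intro k
    have : DifferentiableOn ℂ (f k) (Metric.closedBall μ r) := by
      intro z hz
      have hAz : DifferentiableAt ℂ (A k) z := by
        refine (differentiableAt_const _).sub ?_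
        exact (differentiableAt_const _).clm_comp (hT z)
      obtain ⟨U, hU⟩ := hunit k z hz
      have hi : DifferentiableAt ℂ (Ring.inverse : (E →L[ℂ] E) → _) (A k z) := by
        rw [← hU]
        exact differentiableAt_inverse U.isUnit
      exact ((hi.comp z hAz).clm_apply (differentiableAt_const _)).differentiableWithinAt
    exact this.diffContOnCl_ball subset_rfl
  have hmax : ∀ k, ∃ z ∈ Metric.sphere μ r, ‖w‖ ≤ ‖f k z‖ := by
    intro k
    obtain ⟨z, hz, hzmax⟩ := Complex.exists_mem_frontier_isMaxOn_norm Metric.isBounded_ball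
      ⟨μ, Metric.mem_ball_self hr0⟩ (hdiff k)
    rw [frontier_ball μ hr0.ne'] at hz
    refine ⟨z, hz, ?_⟩
    have := hzmax (subset_closure (Metric.mem_ball_self hr0))
    simpa [hfμ] using this
  choose z hz hzw using hmax
  obtain ⟨ζ, hζ, ψ, hψ, hψz⟩ := (isCompact_sphere μ r).tendsto_subseq hz
  have hw' : 0 < ‖w‖ := norm_pos_iff.2 hw
  have hpos : ∀ k, 0 < ‖f k (z k)‖ := fun k => hw'.trans_le (hzw k)
  -- normalized, these values are approximate fixed points, so there is an eigenvalue on the circle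
  set u : ℕ → E := fun k => ((‖f (ψ k) (z (ψ k))‖ : ℂ)⁻¹) • f (ψ k) (z (ψ k)) with hu
  have hu1 : ∀ k, ‖u k‖ = 1 := fun k => by
    rw [hu]
    simp only [norm_smul, norm_inv, Complex.norm_real, norm_norm]
    exact inv_mul_cancel₀ (hpos _).ne'
  obtain ⟨v, hv, hvu⟩ := exists_fixed_near (φ := φ ∘ ψ) (u := u) hY (hT ζ).continuousAt (hc ζ)
    (hφ.tendsto_atTop.comp hψ.tendsto_atTop) hψz (fun k => (hu1 k).le) (by
      have e : ∀ k, u k - (Y ((φ ∘ ψ) k)).starProjection (T ((z ∘ ψ) k) (u k))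
          = ((‖f (ψ k) (z (ψ k))‖ : ℂ)⁻¹) • x (ψ k) := by
        intro k
        rw [← hAf (ψ k) (z (ψ k)) (Metric.sphere_subset_closedBall (hz _)), ← map_smul, hAapp]
        rfl
      simp only [e]
      have hlim := (hx0.comp hψ.tendsto_atTop).norm.const_mul (‖w‖⁻¹)
      rw [norm_zero, mul_zero] at hlim
      refine squeeze_zero_norm (fun k => ?_) hlim
      rw [norm_smul, norm_inv, Complex.norm_real, norm_norm, Function.comp_apply]
      gcongr
      exact hzw _)
  have hev : ∀ᶠ k in atTop, v k ≠ 0 := by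
    filter_upwards [(tendsto_zero_iff_norm_tendsto_zero.1 hvu).eventually_lt_const one_pos]
      with k hk hk0
    rw [hk0, sub_zero, hu1] at hk
    exact lt_irrefl _ hk
  obtain ⟨k, hk⟩ := hev.exists
  exact hr ⟨ζ, ⟨v k, hk, hv k⟩, hζ⟩

end Abstract

namespace Convection

variable {a s : ℝ}

/-! ### The Volterra operator -/

theorem vol_univ (s : ℝ) : vol s Set.univ = 1 := by
  rw [vol, Measure.restrict_apply_univ, Real.volume_Ioo]
  norm_num

theorem ae_vol_mem (s : ℝ) : ∀ᵐ x ∂(vol s), x ∈ Set.Ioo (s - 1 / 2) (s + 1 / 2) :=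
  ae_restrict_mem measurableSet_Ioo

/-- The indicator function of `(-∞, x]` in `L²(s - 1/2, s + 1/2)`. -/
def ind (s x : ℝ) : L2 s :=
  indicatorConstLp 2 (measurableSet_Iic (a := x)) (measure_ne_top (vol s) _) (1 : ℂ)

/-- The primitive of `f ∈ L²` that vanishes at `s - 1/2`. -/
def prim (f : L2 s) (x : ℝ) : ℂ := ⟪ind s x, f⟫_ℂ

theorem prim_eq (f : L2 s) (x : ℝ) : prim f x = ∫ t in Set.Iic x, f t ∂(vol s) :=
  L2.inner_indicatorConstLp_one _ _ f

theorem norm_ind_sub_le (x y : ℝ) : ‖ind s x - ind s y‖ ≤ √|x - y| := by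
  wlog h : y ≤ x generalizing x y
  · rw [norm_sub_rev, abs_sub_comm]
    exact this y x (le_of_not_ge h)
  have e : ind s x - ind s y = indicatorConstLp 2 (measurableSet_Ioc (a := y) (b := x))
      (measure_ne_top (vol s) _) (1 : ℂ) := by
    rw [sub_eq_iff_eq_add, ind, ind, ← indicatorConstLp_disjoint_union]
    · congr 1
      rw [Set.union_comm, Set.Iic_union_Ioc_eq_Iic h]
    · exact (Set.Iic_disjoint_Ioc le_rfl).symm
  rw [e, norm_indicatorConstLp two_ne_zero ENNReal.ofNat_ne_top, norm_one, one_mul,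
    ENNReal.toReal_ofNat, ← Real.sqrt_eq_rpow]
  refine Real.sqrt_le_sqrt ?_
  have h1 : (vol s) (Set.Ioc y x) ≤ ENNReal.ofReal (x - y) := by
    rw [← Real.volume_Ioc]
    exact Measure.restrict_apply_le _ _
  rw [abs_of_nonneg (sub_nonneg.2 h)]
  exact ENNReal.toReal_le_of_le_ofReal (sub_nonneg.2 h) h1

theorem ind_left (s : ℝ) : ind s (s - 1 / 2) = 0 := by
  refine Lp.ext ((indicatorConstLp_coeFn).trans ?_)
  filter_upwards [Lp.coeFn_zero ℂ 2 (vol s), ae_vol_mem s] with x hx hxI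
  rw [hx, Set.indicator_of_notMem (by simpa using hxI.1)]
  rfl

theorem norm_prim_sub_le (f : L2 s) (x y : ℝ) : ‖prim f x - prim f y‖ ≤ √|x - y| * ‖f‖ := by
  rw [prim, prim, ← inner_sub_left]
  exact (norm_inner_le_norm _ _).trans
    (mul_le_mul_of_nonneg_right (norm_ind_sub_le x y) (norm_nonneg _))

theorem prim_left (f : L2 s) : prim f (s - 1 / 2) = 0 := by
  rw [prim, ind_left, inner_zero_left]

theorem prim_add (f g : L2 s) (x : ℝ) : prim (f + g) x = prim f x + prim g x := inner_add_right ..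

theorem prim_smul (c : ℂ) (f : L2 s) (x : ℝ) : prim (c • f) x = c * prim f x := inner_smul_right ..

theorem continuous_prim (f : L2 s) : Continuous (prim f) := by
  refine continuous_iff_continuousAt.2 fun y => tendsto_iff_norm_sub_tendsto_zero.2 ?_
  refine squeeze_zero (fun _ => norm_nonneg _) (fun x => norm_prim_sub_le f x y) ?_
  have : Continuous fun x => √|x - y| * ‖f‖ := by fun_prop
  simpa using this.tendsto y

theorem norm_prim_le (f : L2 s) {x : ℝ} (hx : x ∈ Set.Icc (s - 1 / 2) (s + 1 / 2)) :
    ‖prim f x‖ ≤ ‖f‖ := by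
  have h := norm_prim_sub_le f x (s - 1 / 2)
  rw [prim_left, sub_zero] at h
  refine h.trans (mul_le_of_le_one_left (norm_nonneg _) (Real.sqrt_le_one.2 ?_))
  rw [abs_le]
  constructor <;> linarith [hx.1, hx.2]

theorem ae_norm_prim_le (f : L2 s) : ∀ᵐ x ∂(vol s), ‖prim f x‖ ≤ ‖f‖ := by
  filter_upwards [ae_vol_mem s] with x hx
  exact norm_prim_le f (Set.Ioo_subset_Icc_self hx)

theorem memLp_prim (f : L2 s) : MemLp (prim f) 2 (vol s) :=
  MemLp.of_bound (continuous_prim f).aestronglyMeasurable ‖f‖ (ae_norm_prim_le f)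

theorem norm_le_of_ae_norm_le {f : L2 s} {C : ℝ} (hC : 0 ≤ C) (h : ∀ᵐ x ∂(vol s), ‖f x‖ ≤ C) :
    ‖f‖ ≤ C := by
  have := Lp.norm_le_of_ae_bound hC h
  simpa [measureUnivNNReal, vol_univ] using this

/-- The Volterra operator `f ↦ ∫_{s - 1/2}^x f`. -/
def volterra (s : ℝ) : L2 s →L[ℂ] L2 s :=
  LinearMap.mkContinuous
    { toFun := fun f => (memLp_prim f).toLp
      map_add' := fun f g => by
        rw [← MemLp.toLp_add]
        exact (MemLp.toLp_eq_toLp_iff _ _).2 (Eventually.of_forall fun x => prim_add f g x)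
      map_smul' := fun c f => by
        rw [← MemLp.toLp_const_smul]
        exact (MemLp.toLp_eq_toLp_iff _ _).2 (Eventually.of_forall fun x => prim_smul c f x) }
    1 fun f => by
      rw [one_mul]
      refine norm_le_of_ae_norm_le (norm_nonneg _) ?_
      filter_upwards [MemLp.coeFn_toLp (memLp_prim f), ae_norm_prim_le f] with x hx hx2
      exact (congrArg norm hx).trans_le hx2

theorem coeFn_volterra (f : L2 s) : volterra s f =ᵐ[vol s] prim f := MemLp.coeFn_toLp (memLp_prim f)

/-- The indicator function of the `k`-th of the `n` equal parts of the interval. -/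
def part (s : ℝ) (n k : ℕ) : L2 s :=
  indicatorConstLp 2
    (measurableSet_Ico (a := s - 1 / 2 + k / (n : ℝ)) (b := s - 1 / 2 + (k + 1) / (n : ℝ)))
    (measure_ne_top (vol s) _) (1 : ℂ)

/-- The operator that replaces the primitive of `f` by a step function with `n` steps. -/
def stepVolterra (s : ℝ) (n : ℕ) : L2 s →L[ℂ] L2 s :=
  ∑ k ∈ Finset.range n, (innerSL ℂ (ind s (s - 1 / 2 + k / n))).smulRight (part s n k)

theorem isCompactOperator_smulRight {E F : Type*} [NormedAddCommGroup E] [NormedSpace ℂ E]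
    [NormedAddCommGroup F] [NormedSpace ℂ F] (c : E →L[ℂ] ℂ) (f : F) :
    IsCompactOperator (c.smulRight f) := by
  have h1 : IsCompactOperator (id : ℂ → ℂ) :=
    (isCompactOperator_id_iff_locallyCompactSpace).2 inferInstance
  exact (h1.comp_clm c).continuous_comp
    (g := fun z : ℂ => z • f) (by fun_prop)

theorem isCompactOperator_sum {ι E F : Type*} [NormedAddCommGroup E] [NormedSpace ℂ E]
    [NormedAddCommGroup F] [NormedSpace ℂ F] (t : Finset ι) (T : ι → E →L[ℂ] F)
    (h : ∀ i ∈ t, IsCompactOperator (T i)) : IsCompactOperator (∑ i ∈ t, T i : E →L[ℂ] F) := by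
  have : (∑ i ∈ t, T i : E →L[ℂ] F) ∈ compactOperator (RingHom.id ℂ) E F :=
    Submodule.sum_mem _ fun i hi => h i hi
  exact this

theorem coeFn_finset_sum {ι : Type*} (t : Finset ι) (f : ι → L2 s) :
    ∀ᵐ x ∂(vol s), (∑ i ∈ t, f i : L2 s) x = ∑ i ∈ t, f i x := by
  classical
  induction t using Finset.induction_on with
  | empty =>
    filter_upwards [Lp.coeFn_zero ℂ 2 (vol s)] with x hx
    rw [Finset.sum_empty, Finset.sum_empty, hx, Pi.zero_apply]
  | insert i t hi ih =>
    rw [Finset.sum_insert hi]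
    filter_upwards [ih, Lp.coeFn_add (f i) (∑ i ∈ t, f i)] with x hx hx2
    rw [hx2, Pi.add_apply, hx, Finset.sum_insert hi]

/-- A value of the step function is a value of the primitive at a point nearby. -/
theorem coeFn_stepVolterra {n : ℕ} (hn : 0 < n) (f : L2 s) : ∀ᵐ x ∂(vol s),
    ∃ y, |x - y| ≤ 1 / (n : ℝ) ∧ stepVolterra s n f x = prim f y := by
  set g : ℕ → ℝ → ℂ := fun k => (Set.Ico (s - 1 / 2 + k / n) (s - 1 / 2 + (k + 1) / n)).indicator
    fun _ => prim f (s - 1 / 2 + k / n) with hg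
  have h1 : ∀ᵐ x ∂(vol s), ∀ k ∈ Finset.range n,
      (prim f (s - 1 / 2 + k / n) • part s n k) x = g k x := by
    refine (Finset.eventually_all _).2 fun k _ => ?_
    filter_upwards [Lp.coeFn_smul (prim f (s - 1 / 2 + k / n)) (part s n k),
      indicatorConstLp_coeFn (p := 2) (μ := vol s)
        (hs := measurableSet_Ico (a := s - 1 / 2 + k / n) (b := s - 1 / 2 + (k + 1) / n))
        (hμs := measure_ne_top (vol s) _) (c := (1 : ℂ))] with x hx hx2
    rw [hx, Pi.smul_apply, part, hx2, hg]
    simp [Set.indicator]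
  have h2 : stepVolterra s n f
      = ∑ k ∈ Finset.range n, prim f (s - 1 / 2 + k / n) • part s n k := by
    rw [stepVolterra, sum_apply]
    rfl
  rw [h2]
  filter_upwards [h1, ae_vol_mem s, coeFn_finset_sum (Finset.range n)
    (fun k : ℕ => prim f (s - 1 / 2 + k / n) • part s n k)] with x hx hxI hsum
  have hn' : (0 : ℝ) < n := by exact_mod_cast hn
  -- the part of the interval that contains `x`
  set k₀ := ⌊(x - (s - 1 / 2)) * n⌋₊ with hk₀
  have hnn : 0 ≤ (x - (s - 1 / 2)) * n := mul_nonneg (by linarith [hxI.1]) hn'.le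
  have hle : (k₀ : ℝ) ≤ (x - (s - 1 / 2)) * n := Nat.floor_le hnn
  have hlt : (x - (s - 1 / 2)) * n < k₀ + 1 := Nat.lt_floor_add_one _
  have hk₀n : k₀ < n := by
    refine (Nat.floor_lt hnn).2 ?_
    nlinarith [hxI.2]
  have hmem : ∀ k : ℕ, x ∈ Set.Ico (s - 1 / 2 + k / n : ℝ) (s - 1 / 2 + (k + 1) / n) ↔ k = k₀ := by
    intro k
    rw [Set.mem_Ico, ← le_sub_iff_add_le', ← sub_lt_iff_lt_add', div_le_iff₀ hn', lt_div_iff₀ hn',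
      eq_comm, hk₀, Nat.floor_eq_iff hnn]
  have hx₀ := (hmem k₀).2 rfl
  refine ⟨s - 1 / 2 + k₀ / n, ?_, ?_⟩
  · rw [abs_of_nonneg (by linarith [hx₀.1])]
    have := hx₀.2
    rw [add_div] at this
    linarith
  · rw [hsum, Finset.sum_eq_single k₀]
    · rw [hx k₀ (Finset.mem_range.2 hk₀n), hg]
      exact Set.indicator_of_mem hx₀ _
    · intro k hk hne
      rw [hx k hk, hg]
      exact Set.indicator_of_notMem (fun h => hne ((hmem k).1 h)) _
    · intro h
      exact absurd (Finset.mem_range.2 hk₀n) h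

theorem isCompactOperator_volterra (s : ℝ) : IsCompactOperator (volterra s) := by
  have hc : ∀ n, IsCompactOperator (stepVolterra s n) := fun n =>
    isCompactOperator_sum _ _ fun k _ => isCompactOperator_smulRight _ _
  refine isCompactOperator_of_tendsto (l := atTop) (F := stepVolterra s) ?_
    (Eventually.of_forall hc)
  rw [tendsto_iff_norm_sub_tendsto_zero]
  have hlim : Tendsto (fun n : ℕ => √(1 / (n : ℝ))) atTop (𝓝 0) := by
    have := (tendsto_one_div_atTop_nhds_zero_nat (𝕜 := ℝ)).sqrt
    rwa [Real.sqrt_zero] at this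
  refine squeeze_zero' (Eventually.of_forall fun _ => norm_nonneg _) ?_ hlim
  filter_upwards [eventually_gt_atTop 0] with n hn
  refine ContinuousLinearMap.opNorm_le_bound _ (Real.sqrt_nonneg _) fun f => ?_
  refine norm_le_of_ae_norm_le (by positivity) ?_
  filter_upwards [coeFn_stepVolterra hn f, coeFn_volterra f,
    Lp.coeFn_sub (stepVolterra s n f) (volterra s f)] with x ⟨y, hy, hxy⟩ hx hsub
  rw [sub_apply, hsub, Pi.sub_apply, hx, hxy]
  refine (norm_prim_sub_le f y x).trans ?_
  rw [abs_sub_comm]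
  gcongr

/-- The integral over the whole interval. -/
def total (s : ℝ) : L2 s →L[ℂ] ℂ := innerSL ℂ (ind s (s + 1 / 2))

/-- The constant function `1` in `L²(s - 1/2, s + 1/2)`. -/
def one (s : ℝ) : L2 s := ind s (s + 1 / 2)

theorem total_apply (f : L2 s) : total s f = prim f (s + 1 / 2) := rfl

theorem coeFn_one (s : ℝ) : one s =ᵐ[vol s] fun _ => 1 := by
  filter_upwards [ae_vol_mem s, indicatorConstLp_coeFn (p := 2) (μ := vol s)
    (hs := measurableSet_Iic (a := s + 1 / 2)) (hμs := measure_ne_top (vol s) _)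
    (c := (1 : ℂ))] with x hx h
  exact h.trans (Set.indicator_of_mem (by exact hx.2.le) _)

theorem prim_eq_intervalIntegral {f : L2 s} {g : ℝ → ℂ} (h : f =ᵐ[vol s] g) {x : ℝ}
    (hx : x ∈ Set.Icc (s - 1 / 2) (s + 1 / 2)) : prim f x = ∫ t in (s - 1 / 2)..x, g t := by
  rw [prim_eq, integral_Iic_vol s g hx]
  exact integral_congr_ae (ae_restrict_of_ae h)

theorem prim_one {x : ℝ} (hx : x ∈ Set.Icc (s - 1 / 2) (s + 1 / 2)) :
    prim (one s) x = x - (s - 1 / 2 : ℝ) := by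
  rw [prim_eq_intervalIntegral (coeFn_one s) hx, intervalIntegral.integral_const, Complex.real_smul,
    mul_one]
  push_cast
  ring

theorem prim_volterra_one {x : ℝ} (hx : x ∈ Set.Icc (s - 1 / 2) (s + 1 / 2)) :
    prim (volterra s (one s)) x = (x - (s - 1 / 2 : ℝ)) ^ 2 / 2 := by
  have h : volterra s (one s) =ᵐ[vol s] fun x => (x : ℂ) - (s - 1 / 2 : ℝ) := by
    filter_upwards [coeFn_volterra (one s), ae_vol_mem s] with x hx hxI
    rw [hx, prim_one (Set.Ioo_subset_Icc_self hxI)]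
  rw [prim_eq_intervalIntegral h hx]
  have hd : ∀ y ∈ Set.uIcc (s - 1 / 2) x, HasDerivAt
      (fun t : ℝ => ((t : ℂ) - (s - 1 / 2 : ℝ)) ^ 2 / 2) ((y : ℂ) - (s - 1 / 2 : ℝ)) y := by
    intro y _
    have := (((Complex.ofRealCLM.hasDerivAt (x := y)).sub_const
      ((s - 1 / 2 : ℝ) : ℂ)).pow 2).div_const 2
    refine this.congr_deriv ?_
    simp
  rw [intervalIntegral.integral_eq_sub_of_hasDerivAt hd
    (Continuous.intervalIntegrable (by fun_prop) _ _)]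
  simp

theorem prim_volterra_volterra_one {x : ℝ} (hx : x ∈ Set.Icc (s - 1 / 2) (s + 1 / 2)) :
    prim (volterra s (volterra s (one s))) x = (x - (s - 1 / 2 : ℝ)) ^ 3 / 6 := by
  have h : volterra s (volterra s (one s)) =ᵐ[vol s]
      fun x => ((x : ℂ) - (s - 1 / 2 : ℝ)) ^ 2 / 2 := by
    filter_upwards [coeFn_volterra (volterra s (one s)), ae_vol_mem s] with x hx hxI
    rw [hx, prim_volterra_one (Set.Ioo_subset_Icc_self hxI)]
  rw [prim_eq_intervalIntegral h hx]
  have hd : ∀ y ∈ Set.uIcc (s - 1 / 2) x, HasDerivAt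
      (fun t : ℝ => ((t : ℂ) - (s - 1 / 2 : ℝ)) ^ 3 / 6)
      (((y : ℂ) - (s - 1 / 2 : ℝ)) ^ 2 / 2) y := by
    intro y _
    have := (((Complex.ofRealCLM.hasDerivAt (x := y)).sub_const
      ((s - 1 / 2 : ℝ) : ℂ)).pow 3).div_const 6
    refine this.congr_deriv ?_
    simp
    ring
  rw [intervalIntegral.integral_eq_sub_of_hasDerivAt hd
    (Continuous.intervalIntegrable (by fun_prop) _ _)]
  simp

theorem right_mem (s : ℝ) : s + 1 / 2 ∈ Set.Icc (s - 1 / 2) (s + 1 / 2) :=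
  Set.right_mem_Icc.2 (by linarith)

theorem total_one (s : ℝ) : total s (one s) = 1 := by
  rw [total_apply, prim_one (right_mem s)]
  push_cast
  ring

theorem total_volterra_one (s : ℝ) : total s (volterra s (one s)) = 1 / 2 := by
  rw [total_apply, prim_volterra_one (right_mem s)]
  push_cast
  ring

theorem total_volterra_volterra_one (s : ℝ) :
    total s (volterra s (volterra s (one s))) = 1 / 6 := by
  rw [total_apply, prim_volterra_volterra_one (right_mem s)]
  push_cast
  ring

/-- The representative `g` is left free, so that it can be the next function of a tower. -/
theorem hasL2Deriv_prim (c : ℂ) {f : L2 s} {g : ℝ → ℂ} (h : f =ᵐ[vol s] g) :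
    HasL2Deriv s (fun x => c + prim f x) g where
  memLp := (memLp_congr_ae h).1 (Lp.memLp f)
  eq_integral x hx := by
    rw [prim_left, add_zero, prim_eq_intervalIntegral h hx]

theorem coeFn_volterra_add (f : L2 s) (c : ℂ) :
    (volterra s f + c • one s : L2 s) =ᵐ[vol s] fun x => c + prim f x := by
  filter_upwards [Lp.coeFn_add (volterra s f) (c • one s), Lp.coeFn_smul c (one s), coeFn_one s,
    coeFn_volterra f] with x h1 h2 h3 h4
  rw [h1, Pi.add_apply, h2, Pi.smul_apply, h3, h4, smul_eq_mul, mul_one, add_comm]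

/-- The weak derivatives do not depend on the chosen representatives. -/
theorem weakD_coeFn_of_tower {n m : ℕ} {u : sob s n m} {F : ℕ → ℝ → ℂ}
    (h : IsTower s n m u F) (k : ℕ) (hk : k ≤ n) : weakD s n m k hk u =ᵐ[vol s] F k := by
  obtain ⟨G, hG, hG'⟩ := exists_tower u
  have h1 := hG.add (h.smul (-1))
  have e : (u : L2 s) + (-1 : ℂ) • (u : L2 s) = 0 := by module
  rw [e] at h1
  filter_upwards [hG' k hk, h1.ae_zero k hk] with x hx h2
  simp only [Pi.add_apply, Pi.smul_apply, Pi.zero_apply, smul_eq_mul] at h2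
  rw [hx]
  linear_combination h2

/-! ### Inverses of `D²` and `D⁴` -/

/-- The first derivative of the solution of `D² Θ = f`, `Θ = 0` at both end points. -/
def dirichletD (s : ℝ) : L2 s →L[ℂ] L2 s :=
  volterra s - (total s ∘L volterra s).smulRight (one s)

/-- The solution operator of `D² Θ = f`, `Θ = 0` at both end points. -/
def dirichlet (s : ℝ) : L2 s →L[ℂ] L2 s := volterra s ∘L dirichletD s

theorem isTower_dirichlet (f : L2 s) : ∃ F : ℕ → ℝ → ℂ,
    IsTower s 2 1 (dirichlet s f) F ∧ F 2 = f := by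
  set c := -total s (volterra s f) with hc
  have hB : dirichletD s f = volterra s f + c • one s := by
    change volterra s f - total s (volterra s f) • one s = _
    rw [hc]; module
  refine ⟨fun k => match k with
    | 0 => fun x => 0 + prim (dirichletD s f) x
    | 1 => fun x => c + prim f x
    | _ => f, ⟨?_, ?_, ?_, ?_⟩, rfl⟩
  · simp only [zero_add]
    exact coeFn_volterra _
  · intro k hk
    interval_cases k
    · exact hasL2Deriv_prim 0 (hB ▸ coeFn_volterra_add f c)
    · exact hasL2Deriv_prim c (ae_eq_refl _)
  · intro j hj
    interval_cases j
    simp only [prim_left, zero_add]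
  · intro j hj
    interval_cases j
    change 0 + total s (dirichletD s f) = 0
    rw [hB, map_add, map_smul, total_one, hc]
    simp

/-- The third derivative of the solution of `D⁴ W = f`, `W = DW = 0` at both end points. The
constants of integration, here and in `clampedD2`, solve the two linear equations that the
conditions at the right end point impose. -/
def clampedD3 (s : ℝ) : L2 s →L[ℂ] L2 s :=
  volterra s + ((12 : ℂ) • (total s ∘L volterra s ∘L volterra s ∘L volterra s)
    - (6 : ℂ) • (total s ∘L volterra s ∘L volterra s)).smulRight (one s)

/-- The second derivative of the solution of `D⁴ W = f`, `W = DW = 0` at both end points. -/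
def clampedD2 (s : ℝ) : L2 s →L[ℂ] L2 s :=
  volterra s ∘L clampedD3 s + ((2 : ℂ) • (total s ∘L volterra s ∘L volterra s)
    - (6 : ℂ) • (total s ∘L volterra s ∘L volterra s ∘L volterra s)).smulRight (one s)

/-- The solution operator of `D⁴ W = f`, `W = DW = 0` at both end points. -/
def clamped (s : ℝ) : L2 s →L[ℂ] L2 s := volterra s ∘L volterra s ∘L clampedD2 s

theorem isTower_clamped (f : L2 s) : ∃ F : ℕ → ℝ → ℂ,
    IsTower s 4 2 (clamped s f) F ∧ F 2 =ᵐ[vol s] clampedD2 s f ∧ F 4 = f := by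
  set p := total s (volterra s (volterra s (volterra s f))) with hp
  set q := total s (volterra s (volterra s f)) with hq
  have h3 : clampedD3 s f = volterra s f + (12 * p - 6 * q) • one s := rfl
  have h2 : clampedD2 s f = volterra s (clampedD3 s f) + (2 * q - 6 * p) • one s := rfl
  refine ⟨fun k => match k with
    | 0 => fun x => 0 + prim (volterra s (clampedD2 s f)) x
    | 1 => fun x => 0 + prim (clampedD2 s f) x
    | 2 => fun x => (2 * q - 6 * p) + prim (clampedD3 s f) x
    | 3 => fun x => (12 * p - 6 * q) + prim f x
    | _ => f, ⟨?_, ?_, ?_, ?_⟩, (h2 ▸ coeFn_volterra_add _ _).symm, rfl⟩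
  · simp only [zero_add]
    exact coeFn_volterra _
  · intro k hk
    interval_cases k
    · refine hasL2Deriv_prim 0 ?_
      simp only [zero_add]
      exact coeFn_volterra _
    · exact hasL2Deriv_prim 0 (h2 ▸ coeFn_volterra_add _ _)
    · exact hasL2Deriv_prim _ (h3 ▸ coeFn_volterra_add _ _)
    · exact hasL2Deriv_prim _ (ae_eq_refl _)
  · intro j hj
    interval_cases j <;> simp only [prim_left, zero_add]
  · intro j hj
    interval_cases j
    · change 0 + total s (volterra s (clampedD2 s f)) = 0
      rw [h2, h3]
      simp only [map_add, map_smul, total_volterra_volterra_one, total_volterra_one, smul_eq_mul]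
      rw [← hp]
      ring
    · change 0 + total s (clampedD2 s f) = 0
      rw [h2, h3]
      simp only [map_add, map_smul, total_one, total_volterra_one, smul_eq_mul]
      rw [← hq]
      ring

theorem dirichlet_mem (f : L2 s) : dirichlet s f ∈ sob s 2 1 :=
  let ⟨F, hF, _⟩ := isTower_dirichlet f
  ⟨F, hF⟩

theorem clamped_mem (f : L2 s) : clamped s f ∈ sob s 4 2 :=
  let ⟨F, hF, _⟩ := isTower_clamped f
  ⟨F, hF⟩

theorem weakD_dirichlet (f : L2 s) :
    weakD s 2 1 2 (by omega) ⟨dirichlet s f, dirichlet_mem f⟩ = f := by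
  obtain ⟨F, hF, h2⟩ := isTower_dirichlet f
  have := weakD_coeFn_of_tower (u := ⟨dirichlet s f, dirichlet_mem f⟩) hF 2 (by omega)
  rw [h2] at this
  exact Lp.ext this

theorem weakD_clamped (f : L2 s) :
    weakD s 4 2 4 (by omega) ⟨clamped s f, clamped_mem f⟩ = f ∧
    weakD s 4 2 2 (by omega) ⟨clamped s f, clamped_mem f⟩ = clampedD2 s f := by
  obtain ⟨F, hF, h2, h4⟩ := isTower_clamped f
  have e2 := weakD_coeFn_of_tower (u := ⟨clamped s f, clamped_mem f⟩) hF 2 (by omega)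
  have e4 := weakD_coeFn_of_tower (u := ⟨clamped s f, clamped_mem f⟩) hF 4 (by omega)
  rw [h4] at e4
  exact ⟨Lp.ext e4, Lp.ext (e2.trans h2)⟩

theorem isCompactOperator_dirichlet (s : ℝ) : IsCompactOperator (dirichlet s) :=
  (isCompactOperator_volterra s).comp_clm _

theorem isCompactOperator_clamped (s : ℝ) : IsCompactOperator (clamped s) :=
  (isCompactOperator_volterra s).comp_clm _

theorem isCompactOperator_clampedD2 (s : ℝ) : IsCompactOperator (clampedD2 s) :=
  ((isCompactOperator_volterra s).comp_clm _).add (isCompactOperator_smulRight _ _)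

/-! ### The compact inverse of `diag ((D² - a²)², a² - D²)` -/

/-- The operator `diag ((D² - a²)², a² - D²)` is coercive. -/
theorem exists_coercive {a : ℝ} (ha : 0 < a) (s : ℝ) :
    ∃ γ > 0, ∀ w : dom s, γ * ‖(w : H s)‖ ^ 2 ≤ (⟪diffOp a s (-1) w, (w : H s)⟫_ℂ).re := by
  refine ⟨min (a ^ 4) (a ^ 2), by positivity, fun w => ?_⟩
  rw [re_inner_diffOp, WithLp.prod_norm_sq_eq_of_L2]
  have h1 : min (a ^ 4) (a ^ 2) * ‖(w : H s).fst‖ ^ 2 ≤ a ^ 4 * ‖(w : H s).fst‖ ^ 2 := by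
    gcongr; exact min_le_left _ _
  have h2 : min (a ^ 4) (a ^ 2) * ‖(w : H s).snd‖ ^ 2 ≤ a ^ 2 * ‖(w : H s).snd‖ ^ 2 := by
    gcongr; exact min_le_right _ _
  have p1 := sq_nonneg ‖weakD s 4 2 2 (by omega) (compW s w)‖
  have p2 : 0 ≤ 2 * a ^ 2 * ‖weakD s 4 2 1 (by omega) (compW s w)‖ ^ 2 := by positivity
  have p4 := sq_nonneg ‖weakD s 2 1 1 (by omega) (compT s w)‖
  rw [mul_add]
  linarith

theorem eq_zero_of_inner_diffOp {a : ℝ} (ha : 0 < a) {w : dom s}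
    (h : ⟪diffOp a s (-1) w, (w : H s)⟫_ℂ = 0) : w = 0 := by
  obtain ⟨γ, hγ, hw⟩ := exists_coercive ha s
  have h1 := hw w
  rw [h, Complex.zero_re] at h1
  have h2 : ‖(w : H s)‖ ^ 2 ≤ 0 := by
    by_contra h3
    exact absurd (mul_pos hγ (not_le.1 h3)) (not_lt.2 h1)
  exact Subtype.ext
    (norm_eq_zero.1 (pow_eq_zero_iff two_ne_zero |>.1 (le_antisymm h2 (sq_nonneg _))))

theorem diffOp_eq_zero {a : ℝ} (ha : 0 < a) {w : dom s} (h : diffOp a s (-1) w = 0) : w = 0 :=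
  eq_zero_of_inner_diffOp ha (by rw [h, inner_zero_left])

/-- The element `(W, Θ)` of the domain. -/
def mkDom (W : sob s 4 2) (Θ : sob s 2 1) : dom s :=
  ⟨WithLp.toLp 2 ((W : L2 s), (Θ : L2 s)), W.2, Θ.2⟩

theorem diffOp_mkDom (a : ℝ) (σ : ℂ) (W : sob s 4 2) (Θ : sob s 2 1) :
    diffOp a s σ (mkDom W Θ) = WithLp.toLp 2 (fourthOp a s W, σ • secondOp a s Θ) := rfl

theorem fourthOp_eq_zero {a : ℝ} (ha : 0 < a) {W : sob s 4 2} (h : fourthOp a s W = 0) : W = 0 := by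
  have h1 : mkDom W (0 : sob s 2 1) = 0 := diffOp_eq_zero ha (by
    rw [diffOp_mkDom, h, map_zero, smul_zero]; rfl)
  exact Subtype.ext (congrArg (fun w : dom s => (w : H s).fst) h1)

theorem secondOp_eq_zero {a : ℝ} (ha : 0 < a) {Θ : sob s 2 1} (h : secondOp a s Θ = 0) : Θ = 0 := by
  have h1 : mkDom (0 : sob s 4 2) Θ = 0 := diffOp_eq_zero ha (by
    rw [diffOp_mkDom, h, map_zero, smul_zero]; rfl)
  exact Subtype.ext (congrArg (fun w : dom s => (w : H s).snd) h1)

/-- Composed with the solution operator of its leading term, `(D² - a²)²` is a compact perturbation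
of the identity. -/
theorem fourthOp_clamped (a : ℝ) (f : L2 s) : fourthOp a s ⟨clamped s f, clamped_mem f⟩
    = f - ((2 * a ^ 2 : ℂ) • clampedD2 s f - (a ^ 4 : ℂ) • clamped s f) := by
  obtain ⟨h4, h2⟩ := weakD_clamped f
  simp only [fourthOp, LinearMap.add_apply, LinearMap.sub_apply, LinearMap.smul_apply,
    Submodule.subtype_apply, h4, h2]
  abel

theorem secondOp_dirichlet (a : ℝ) (f : L2 s) : secondOp a s ⟨dirichlet s f, dirichlet_mem f⟩
    = f - (a ^ 2 : ℂ) • dirichlet s f := by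
  simp only [secondOp, LinearMap.sub_apply, LinearMap.smul_apply, Submodule.subtype_apply,
    weakD_dirichlet]

/-- If `G` and `C` are compact, `G` maps injectively into the domain `D` of an injective map `L`,
and `L G = 1 - C`, then `L` has a compact inverse: `1 - C` is injective, hence invertible. -/
theorem exists_compact_solution {D : Submodule ℂ (L2 s)} (L : D →ₗ[ℂ] L2 s)
    (hL : ∀ u, L u = 0 → u = 0) (G C : L2 s →L[ℂ] L2 s) (hG : IsCompactOperator G)
    (hC : IsCompactOperator C) (hGD : ∀ f, G f ∈ D) (hG0 : ∀ f, G f = 0 → f = 0)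
    (h : ∀ f, L ⟨G f, hGD f⟩ = f - C f) :
    ∃ S : L2 s →L[ℂ] L2 s, IsCompactOperator S ∧ ∀ f, ∃ hf : S f ∈ D, L ⟨S f, hf⟩ = f := by
  obtain ⟨U, hU⟩ := hC.isUnit_one_sub fun f hf => by
    refine hG0 f (congrArg Subtype.val (hL ⟨G f, hGD f⟩ ?_))
    rw [h, hf, sub_self]
  refine ⟨G ∘L (↑U⁻¹ : L2 s →L[ℂ] L2 s), hG.comp_clm _, fun f => ⟨hGD _, ?_⟩⟩
  have h1 := congrArg (fun B : L2 s →L[ℂ] L2 s => B f) U.mul_inv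
  have h2 := h ((↑U⁻¹ : L2 s →L[ℂ] L2 s) f)
  refine h2.trans ?_
  rw [hU] at h1
  exact h1

theorem exists_compact_inverse_fourthOp {a : ℝ} (ha : 0 < a) (s : ℝ) :
    ∃ S : L2 s →L[ℂ] L2 s, IsCompactOperator S ∧
      ∀ f, ∃ hf : S f ∈ sob s 4 2, fourthOp a s ⟨S f, hf⟩ = f := by
  refine exists_compact_solution (fourthOp a s) (fun u => fourthOp_eq_zero ha) (clamped s)
    ((2 * a ^ 2 : ℂ) • clampedD2 s - (a ^ 4 : ℂ) • clamped s) (isCompactOperator_clamped s)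
    (((isCompactOperator_clampedD2 s).smul _).sub ((isCompactOperator_clamped s).smul _))
    clamped_mem (fun f hf => ?_) (fourthOp_clamped a)
  have h := (weakD_clamped f).1
  have h0 : (⟨clamped s f, clamped_mem f⟩ : sob s 4 2) = 0 := Subtype.ext hf
  rw [h0, map_zero] at h
  exact h.symm

theorem exists_compact_inverse_secondOp {a : ℝ} (ha : 0 < a) (s : ℝ) :
    ∃ S : L2 s →L[ℂ] L2 s, IsCompactOperator S ∧
      ∀ f, ∃ hf : S f ∈ sob s 2 1, secondOp a s ⟨S f, hf⟩ = f := by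
  refine exists_compact_solution (secondOp a s) (fun u => secondOp_eq_zero ha) (dirichlet s)
    ((a ^ 2 : ℂ) • dirichlet s) (isCompactOperator_dirichlet s)
    ((isCompactOperator_dirichlet s).smul (a ^ 2 : ℂ))
    dirichlet_mem (fun f hf => ?_) (secondOp_dirichlet a)
  have h := weakD_dirichlet f
  have h0 : (⟨dirichlet s f, dirichlet_mem f⟩ : sob s 2 1) = 0 := Subtype.ext hf
  rw [h0, map_zero] at h
  exact h.symm

theorem exists_compact_inverse_diffOp {a : ℝ} (ha : 0 < a) (s : ℝ) :
    ∃ S : H s →L[ℂ] H s, IsCompactOperator S ∧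
      ∀ f, ∃ hf : S f ∈ dom s, diffOp a s (-1) ⟨S f, hf⟩ = f := by
  obtain ⟨S, hS, hS'⟩ := exists_compact_inverse_fourthOp ha s
  obtain ⟨R, hR, hR'⟩ := exists_compact_inverse_secondOp ha s
  set e := (WithLp.prodContinuousLinearEquiv 2 ℂ (L2 s) (L2 s)).symm
  refine ⟨(e : L2 s × L2 s →L[ℂ] H s) ∘L
    (ContinuousLinearMap.inl ℂ (L2 s) (L2 s) ∘L S ∘L WithLp.fstL 2 ℂ (L2 s) (L2 s)
      - ContinuousLinearMap.inr ℂ (L2 s) (L2 s) ∘L R ∘L WithLp.sndL 2 ℂ (L2 s) (L2 s)), ?_, ?_⟩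
  · refine IsCompactOperator.clm_comp (IsCompactOperator.sub ?_ ?_) (e : L2 s × L2 s →L[ℂ] H s)
    · exact (hS.comp_clm (WithLp.fstL 2 ℂ (L2 s) (L2 s))).clm_comp
        (ContinuousLinearMap.inl ℂ (L2 s) (L2 s))
    · exact (hR.comp_clm (WithLp.sndL 2 ℂ (L2 s) (L2 s))).clm_comp
        (ContinuousLinearMap.inr ℂ (L2 s) (L2 s))
  · intro f
    obtain ⟨h1, h1'⟩ := hS' f.fst
    obtain ⟨h2, h2'⟩ := hR' f.snd
    set w := mkDom ⟨S f.fst, h1⟩ (-⟨R f.snd, h2⟩ : sob s 2 1) with hw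
    have hwf : (w : H s) = ((e : L2 s × L2 s →L[ℂ] H s) ∘L
      (ContinuousLinearMap.inl ℂ (L2 s) (L2 s) ∘L S ∘L WithLp.fstL 2 ℂ (L2 s) (L2 s)
      - ContinuousLinearMap.inr ℂ (L2 s) (L2 s) ∘L R ∘L WithLp.sndL 2 ℂ (L2 s) (L2 s))) f := by
      refine WithLp.ofLp_injective 2 (Prod.ext ?_ ?_)
      · change S f.fst = S f.fst - 0
        rw [sub_zero]
      · change -R f.snd = 0 - R f.snd
        rw [zero_sub]
    rw [← hwf]
    refine ⟨w.2, ?_⟩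
    change diffOp a s (-1) w = f
    rw [hw, diffOp_mkDom, h1', map_neg, h2', neg_one_smul, neg_neg]
    rfl

/-! ### Reflection and self-adjointness -/

/-- The reflection `(W, Θ) ↦ (W, -Θ)`. -/
def reflect (s : ℝ) : H s →ₗ[ℂ] H s where
  toFun w := WithLp.toLp 2 (w.fst, -w.snd)
  map_add' u v := by
    rw [WithLp.add_fst, WithLp.add_snd, neg_add]
    rfl
  map_smul' c u := by
    rw [RingHom.id_apply, WithLp.smul_fst, WithLp.smul_snd, ← smul_neg]
    rfl

theorem reflect_reflect (w : H s) : reflect s (reflect s w) = w :=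
  WithLp.ofLp_injective 2 (Prod.ext rfl (neg_neg _))

theorem reflect_injective (s : ℝ) : Function.Injective (reflect s) :=
  Function.LeftInverse.injective reflect_reflect

theorem inner_reflect (u v : H s) : ⟪reflect s u, v⟫_ℂ = ⟪u, reflect s v⟫_ℂ := by
  rw [WithLp.prod_inner_apply, WithLp.prod_inner_apply]
  change ⟪u.fst, v.fst⟫_ℂ + ⟪-u.snd, v.snd⟫_ℂ = ⟪u.fst, v.fst⟫_ℂ + ⟪u.snd, -v.snd⟫_ℂ
  rw [inner_neg_left, inner_neg_right]

theorem reflect_mem {w : H s} (hw : w ∈ dom s) : reflect s w ∈ dom s :=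
  ⟨hw.1, (sob s 2 1).neg_mem hw.2⟩

theorem reflect_toLp (f g : L2 s) : reflect s (WithLp.toLp 2 (f, g)) = WithLp.toLp 2 (f, -g) := rfl

theorem diffOp_eq (σ : ℂ) (w : dom s) :
    diffOp a s σ w = WithLp.toLp 2 (fourthOp a s (compW s w), σ • secondOp a s (compT s w)) := rfl

theorem diffOp_one (w : dom s) : diffOp a s 1 w = reflect s (diffOp a s (-1) w) := by
  rw [diffOp_eq, diffOp_eq, reflect_toLp, neg_one_smul, neg_neg, one_smul]

theorem diffOp_reflect (w : dom s) :
    diffOp a s (-1) ⟨reflect s w, reflect_mem w.2⟩ = reflect s (diffOp a s (-1) w) := by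
  have hW : compW s ⟨reflect s w, reflect_mem w.2⟩ = compW s w := rfl
  have hT : compT s ⟨reflect s w, reflect_mem w.2⟩ = -compT s w := rfl
  rw [diffOp_eq, hW, hT, diffOp_eq, reflect_toLp, map_neg, smul_neg]

theorem couple_eq_reflect (N : ℝ) (d : ℂ) (w : H s) :
    couple N s d w = reflect s (couple N s (-d) w) := by
  refine WithLp.ofLp_injective 2 (Prod.ext rfl ?_)
  change d • weight N s w.fst = -((-d) • weight N s w.fst)
  module

theorem inner_diffOp_symm (u v : dom s) :
    ⟪diffOp a s (-1) u, (v : H s)⟫_ℂ = ⟪(u : H s), diffOp a s (-1) v⟫_ℂ := by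
  rw [← inner_conj_symm (u : H s)]
  exact ((energyCore a s).conj_inner_symm (toEnergy a s u) (toEnergy a s v)).symm

theorem inner_diffOp_one_symm (u v : dom s) :
    ⟪diffOp a s 1 u, (v : H s)⟫_ℂ = ⟪(u : H s), diffOp a s 1 v⟫_ℂ := by
  rw [diffOp_one, diffOp_one, inner_reflect, ← diffOp_reflect, ← inner_diffOp_symm]

theorem bijective_diffOp (ha : 0 < a) (s : ℝ) : Function.Bijective (diffOp a s (-1)) := by
  refine ⟨(injective_iff_map_eq_zero _).2 fun w => diffOp_eq_zero ha, fun f => ?_⟩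
  obtain ⟨S, -, hS⟩ := exists_compact_inverse_diffOp ha s
  obtain ⟨h, hf⟩ := hS f
  exact ⟨_, hf⟩

theorem bijective_diffOp_one (ha : 0 < a) (s : ℝ) : Function.Bijective (diffOp a s 1) := by
  have h : ⇑(diffOp a s 1) = reflect s ∘ diffOp a s (-1) := funext diffOp_one
  rw [h]
  exact (Function.Involutive.bijective (f := reflect s) reflect_reflect).comp
    (bijective_diffOp ha s)

/-- A vector orthogonal to the domain is `A₊ w` for some `w` in the domain, and then `w = 0` by
coercivity. -/
theorem dense_dom (ha : 0 < a) (s : ℝ) : Dense (dom s : Set (H s)) := by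
  rw [Submodule.dense_iff_topologicalClosure_eq_top, Submodule.topologicalClosure_eq_top_iff,
    Submodule.eq_bot_iff]
  intro h hh
  obtain ⟨w, rfl⟩ := (bijective_diffOp ha s).2 h
  rw [eq_zero_of_inner_diffOp ha (Submodule.inner_left_of_mem_orthogonal w.2 hh), map_zero]

theorem isSelfAdjoint_opA (ha : 0 < a) (s : ℝ) : IsSelfAdjoint (opA a s (-1)) :=
  LinearPMap.isSelfAdjoint_of_surjective (dense_dom ha s) inner_diffOp_symm
    (bijective_diffOp ha s).2

theorem isSelfAdjoint_opA_one (ha : 0 < a) (s : ℝ) : IsSelfAdjoint (opA a s 1) :=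
  LinearPMap.isSelfAdjoint_of_surjective (dense_dom ha s) inner_diffOp_one_symm
    (bijective_diffOp_one ha s).2

/-- The inverse of `diag ((D² - a²)², a² - D²)`. -/
def solve (ha : 0 < a) (s : ℝ) : H s →ₗ[ℂ] dom s :=
  (LinearEquiv.ofBijective (diffOp a s (-1)) (bijective_diffOp ha s)).symm

theorem diffOp_solve (ha : 0 < a) (f : H s) : diffOp a s (-1) (solve ha s f) = f :=
  (LinearEquiv.ofBijective (diffOp a s (-1)) (bijective_diffOp ha s)).apply_symm_apply f

theorem solve_eq_iff (ha : 0 < a) {f : H s} {w : dom s} :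
    solve ha s f = w ↔ diffOp a s (-1) w = f := by
  rw [← (bijective_diffOp ha s).1.eq_iff, diffOp_solve, eq_comm]

/-! ### The energy space -/

/-- The canonical embedding of the domain into `H₀`, as a linear map. -/
def embed (a s : ℝ) : dom s →ₗ[ℂ] H0 a s :=
  (UniformSpace.Completion.toComplₗᵢ (𝕜 := ℂ) (E := EnergyDomain a s)).toLinearMap
    ∘ₗ (toEnergy a s).toLinearMap

theorem norm_embed (w : dom s) : ‖embed a s w‖ = energyNorm a s w :=
  UniformSpace.Completion.norm_coe _

theorem inner_embed (u v : dom s) :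
    ⟪embed a s u, embed a s v⟫_ℂ = ⟪diffOp a s (-1) u, (v : H s)⟫_ℂ :=
  UniformSpace.Completion.inner_coe _ _

theorem embed_injective (a s : ℝ) : Function.Injective (embed a s) :=
  (UniformSpace.Completion.coe_injective _).comp (toEnergy a s).injective

theorem dense_range_embed (a s : ℝ) : Dense (Set.range (embed a s)) := by
  have h : Set.range (embed a s) = Set.range ((↑) : EnergyDomain a s → H0 a s) :=
    (toEnergy a s).surjective.range_comp _
  rw [h]
  exact UniformSpace.Completion.denseRange_coe

theorem exists_norm_embed_solve_le (ha : 0 < a) (s : ℝ) :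
    ∃ C, ∀ f, ‖(embed a s ∘ₗ solve ha s) f‖ ≤ C * ‖f‖ := by
  obtain ⟨γ, hγ, hw⟩ := exists_coercive ha s
  have hg : 0 < √γ := Real.sqrt_pos.2 hγ
  refine ⟨(√γ)⁻¹, fun f => ?_⟩
  set w := solve ha s f with hwf
  change ‖embed a s w‖ ≤ _
  have e : ‖embed a s w‖ ^ 2 = (⟪diffOp a s (-1) w, (w : H s)⟫_ℂ).re := by
    rw [← inner_embed, inner_self_eq_norm_sq_to_K]
    norm_cast
  have h1 : √γ * ‖(w : H s)‖ ≤ ‖embed a s w‖ := by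
    refine le_of_sq_le_sq ?_ (norm_nonneg _)
    rw [mul_pow, Real.sq_sqrt hγ.le, e]
    exact hw w
  have h2 : ‖embed a s w‖ ^ 2 ≤ ‖f‖ * ‖(w : H s)‖ := by
    rw [e, hwf, diffOp_solve]
    exact (Complex.re_le_norm _).trans (norm_inner_le_norm _ _)
  rw [inv_mul_eq_div, le_div_iff₀ hg]
  rcases (norm_nonneg (embed a s w)).eq_or_lt with h0 | h0
  · rw [← h0, zero_mul]; exact norm_nonneg _
  · refine le_of_mul_le_mul_right ?_ h0
    calc ‖embed a s w‖ * √γ * ‖embed a s w‖ = ‖embed a s w‖ ^ 2 * √γ := by ring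
      _ ≤ ‖f‖ * ‖(w : H s)‖ * √γ := by gcongr
      _ = ‖f‖ * (√γ * ‖(w : H s)‖) := by ring
      _ ≤ ‖f‖ * ‖embed a s w‖ := by gcongr

/-- The inverse of `diag ((D² - a²)², a² - D²)` as a bounded operator from `L²` to `H₀`. -/
def green (ha : 0 < a) (s : ℝ) : H s →L[ℂ] H0 a s :=
  (embed a s ∘ₗ solve ha s).mkContinuousOfExistsBound (exists_norm_embed_solve_le ha s)

theorem green_apply (ha : 0 < a) (f : H s) : green ha s f = embed a s (solve ha s f) := rfl

/-- The inclusion of `H₀` in `L²`, obtained as the adjoint of `green`. -/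
def incl (ha : 0 < a) (s : ℝ) : H0 a s →L[ℂ] H s := ContinuousLinearMap.adjoint (green ha s)

theorem inner_green_embed (ha : 0 < a) (f : H s) (w : dom s) :
    ⟪green ha s f, embed a s w⟫_ℂ = ⟪f, (w : H s)⟫_ℂ := by
  rw [green_apply, inner_embed, diffOp_solve]

theorem incl_embed (ha : 0 < a) (w : dom s) : incl ha s (embed a s w) = w := by
  refine ext_inner_left ℂ fun f => ?_
  rw [incl, ContinuousLinearMap.adjoint_inner_right, inner_green_embed]

theorem incl_green (ha : 0 < a) (f : H s) : incl ha s (green ha s f) = solve ha s f := by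
  rw [green_apply, incl_embed]

theorem isCompactOperator_incl_green (ha : 0 < a) (s : ℝ) :
    IsCompactOperator (incl ha s ∘L green ha s) := by
  obtain ⟨S, hS, hS'⟩ := exists_compact_inverse_diffOp ha s
  have : incl ha s ∘L green ha s = S := by
    ext1 f
    obtain ⟨h, hf⟩ := hS' f
    rw [ContinuousLinearMap.comp_apply, incl_green, (solve_eq_iff ha).2 hf]
  rwa [this]

theorem isCompactOperator_green (ha : 0 < a) (s : ℝ) : IsCompactOperator (green ha s) :=
  (isCompactOperator_incl_green ha s).of_adjoint_comp_self

theorem exists_norm_couple_le (N s : ℝ) (d : ℂ) : ∃ C, ∀ w, ‖couple N s d w‖ ≤ C * ‖w‖ := by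
  have hw : ∀ f, ‖weight N s f‖ ≤ (|N| + 1) * ‖f‖ := by
    intro f
    refine Lp.norm_le_mul_norm_of_ae_le_mul ?_
    filter_upwards [MemLp.coeFn_toLp (memLp_weight N s f), ae_vol_mem s] with x hx hxI
    have e : weight N s f x = ((N * (x - s) - 1 : ℝ) : ℂ) * f x := hx
    rw [e, norm_mul, Complex.norm_real, Real.norm_eq_abs]
    gcongr
    have h1 : |x - s| ≤ 1 := abs_le.2 ⟨by linarith [hxI.1], by linarith [hxI.2]⟩
    calc |N * (x - s) - 1| ≤ |N * (x - s)| + |1| := abs_sub _ _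
      _ ≤ |N| + 1 := by
        rw [abs_one, abs_mul]
        gcongr
        exact mul_le_of_le_one_right (abs_nonneg N) h1
  refine ⟨1 + ‖d‖ * (|N| + 1), fun w => ?_⟩
  have h1 : ‖w.fst‖ ≤ ‖w‖ := WithLp.norm_fst_le _ w
  have h2 : ‖w.snd‖ ≤ ‖w‖ := WithLp.norm_snd_le _ w
  have e : couple N s d w = WithLp.toLp 2 (w.snd, 0) + WithLp.toLp 2 (0, d • weight N s w.fst) := by
    rw [← WithLp.toLp_add, Prod.mk_add_mk, add_zero, zero_add]
    rfl
  calc ‖couple N s d w‖ ≤ ‖w.snd‖ + ‖d • weight N s w.fst‖ := by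
        rw [e]
        refine (norm_add_le _ _).trans ?_
        rw [WithLp.norm_toLp_fst, WithLp.norm_toLp_snd]
    _ ≤ ‖w‖ + ‖d‖ * ((|N| + 1) * ‖w‖) := by
        rw [norm_smul]
        gcongr
        exact (hw _).trans (by gcongr)
    _ = _ := by ring

/-- The bounded operator `couple` on `L²`. -/
def coupleL (N s : ℝ) (d : ℂ) : H s →L[ℂ] H s :=
  (couple N s d).mkContinuousOfExistsBound (exists_norm_couple_le N s d)

/-! ### Convergence of the Galerkin method -/

/-- The operator `A₊⁻¹ B` on `H₀`, for a bounded operator `B` on `L²`. -/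
def energyOp (ha : 0 < a) (B : H s →L[ℂ] H s) : H0 a s →L[ℂ] H0 a s :=
  green ha s ∘L B ∘L incl ha s

theorem energyOp_embed (ha : 0 < a) (B : H s →L[ℂ] H s) (w : dom s) :
    energyOp ha B (embed a s w) = embed a s (solve ha s (B w)) := by
  change green ha s (B (incl ha s (embed a s w))) = _
  rw [incl_embed, green_apply]

theorem isCompactOperator_energyOp (ha : 0 < a) (B : H s →L[ℂ] H s) :
    IsCompactOperator (energyOp ha B) :=
  (isCompactOperator_green ha s).comp_clm (B ∘L incl ha s)

/-- Eigenpairs are fixed points of `A₊⁻¹ B`. -/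
theorem energyOp_embed_eq_iff (ha : 0 < a) (B : H s →L[ℂ] H s) (w : dom s) :
    energyOp ha B (embed a s w) = embed a s w ↔ diffOp a s (-1) w = B w := by
  rw [energyOp_embed, (embed_injective a s).eq_iff, solve_eq_iff]

theorem inner_embed_sub_energyOp (ha : 0 < a) (B : H s →L[ℂ] H s) (v w : dom s) :
    ⟪embed a s v, embed a s w - energyOp ha B (embed a s w)⟫_ℂ
      = ⟪(v : H s), diffOp a s (-1) w - B w⟫_ℂ := by
  rw [energyOp_embed, ← map_sub, ← inner_conj_symm, inner_embed, inner_conj_symm, map_sub,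
    diffOp_solve]

/-- The Galerkin equation is the fixed point equation for the projected operator. -/
theorem starProjection_energyOp_eq_iff (ha : 0 < a) (B : H s →L[ℂ] H s) (X : Submodule ℂ (dom s))
    [(X.map (embed a s)).HasOrthogonalProjection] (w : dom s) :
    (X.map (embed a s)).starProjection (energyOp ha B (embed a s w)) = embed a s w ↔
      w ∈ X ∧ ∀ v ∈ X, ⟪(v : H s), diffOp a s (-1) w - B w⟫_ℂ = 0 := by
  constructor
  · intro h
    constructor
    · have h1 := (X.map (embed a s)).starProjection_apply_mem (energyOp ha B (embed a s w))
      rw [h] at h1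
      obtain ⟨x, hx, hxw⟩ := h1
      exact embed_injective a s hxw ▸ hx
    · intro v hv
      rw [← inner_embed_sub_energyOp ha]
      have h1 := (X.map (embed a s)).sub_starProjection_mem_orthogonal
        (energyOp ha B (embed a s w))
      rw [h] at h1
      rw [← neg_sub, inner_neg_right, Submodule.inner_right_of_mem_orthogonal
        (Submodule.mem_map_of_mem hv) h1, neg_zero]
  · rintro ⟨hw, h⟩
    refine Submodule.eq_starProjection_of_mem_orthogonal (Submodule.mem_map_of_mem hw) ?_
    rw [Submodule.mem_orthogonal]
    rintro _ ⟨v, hv, rfl⟩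
    rw [← neg_sub, inner_neg_right, inner_embed_sub_energyOp, h v hv, neg_zero]

/-- Convergence of the Galerkin method for `A₊ w = B(μ) w`, where `B` is an analytic family of
bounded operators on `L²` and the eigenvalues are countable. -/
theorem galerkinConverges (ha : 0 < a) {B : ℂ → H s →L[ℂ] H s} (hB : Differentiable ℂ B)
    (hcount : {μ | ∃ w, IsEigenpair (diffOp a s (-1))
      (fun μ => (B μ : H s →ₗ[ℂ] H s)) μ w}.Countable)
    {X : ℕ → Submodule ℂ (dom s)} (hX : IsTrialFamily a s X) :
    GalerkinConverges a (diffOp a s (-1)) (fun μ => (B μ : H s →ₗ[ℂ] H s)) X := by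
  have hfin := hX.finite
  set Y : ℕ → Submodule ℂ (H0 a s) := fun n => (X n).map (embed a s) with hYdef
  have hYfin : ∀ n, FiniteDimensional ℂ (Y n) := fun n => by rw [hYdef]; infer_instance
  have hY : ∀ u, Tendsto (fun n => (Y n).starProjection u) atTop (𝓝 u) := by
    refine tendsto_starProjection_of_forall_near (dense_range_embed a s) ?_
    rintro _ ⟨u, rfl⟩ ε hε
    obtain ⟨n₀, hn₀⟩ := hX.complete u ε hε
    filter_upwards [eventually_ge_atTop n₀] with n hn
    obtain ⟨v, hv, hvε⟩ := hn₀ n hn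
    refine ⟨embed a s v, Submodule.mem_map_of_mem hv, ?_⟩
    rwa [← map_sub, norm_embed]
  set T : ℂ → H0 a s →L[ℂ] H0 a s := fun z => energyOp ha (B z) with hT
  have hTd : Differentiable ℂ T := by
    intro z
    exact (differentiableAt_const _).clm_comp ((hB z).clm_comp (differentiableAt_const _))
  have hTc : ∀ z, IsCompactOperator (T z) := fun z => isCompactOperator_energyOp ha _
  have heig : ∀ z h, T z h = h → embed a s (solve ha s (B z (incl ha s h))) = h := fun z h hh => hh
  have hcount' : {z | ∃ v, v ≠ 0 ∧ T z v = v}.Countable := by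
    refine hcount.mono ?_
    rintro z ⟨h, h0, hz⟩
    have e := heig z h hz
    refine ⟨solve ha s (B z (incl ha s h)), fun h1 => h0 ?_, ?_⟩
    · rw [← e, h1, map_zero]
    · rw [← e] at hz
      exact (energyOp_embed_eq_iff ha (B z) _).1 hz
  have main : ∀ (φ : ℕ → ℕ) (m : ℕ → ℂ) (v : ℕ → dom s) (μ : ℂ), Tendsto φ atTop atTop →
      (∀ k, IsGalerkinEigenpair (diffOp a s (-1)) (fun μ => (B μ : H s →ₗ[ℂ] H s)) (X (φ k)) (m k)
        (v k)) → Tendsto m atTop (𝓝 μ) →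
      ∃ w : ℕ → dom s,
        (∀ᶠ k in atTop, IsEigenpair (diffOp a s (-1)) (fun μ => (B μ : H s →ₗ[ℂ] H s)) μ (w k)) ∧
        Tendsto (fun k => energyNorm a s (v k - w k) / energyNorm a s (v k)) atTop (𝓝 0) ∧
        Tendsto (fun k => ‖((v k - w k : dom s) : H s)‖ / ‖(v k : H s)‖) atTop (𝓝 0) := by
    intro φ m v μ hφ hv hm
    set h : ℕ → H0 a s := fun k => embed a s (v k) with hh
    have hpos : ∀ k, 0 < ‖h k‖ := fun k => norm_pos_iff.2 fun h0 =>
      (hv k).1 (embed_injective a s (h0.trans (map_zero _).symm))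
    set c : ℕ → ℂ := fun k => (‖h k‖ : ℂ) with hc
    have hc0 : ∀ k, c k ≠ 0 := fun k => Complex.ofReal_ne_zero.2 (hpos k).ne'
    have hcn : ∀ k, ‖c k‖ = ‖h k‖ := fun k => by rw [hc, Complex.norm_real, norm_norm]
    set u : ℕ → H0 a s := fun k => (c k)⁻¹ • h k with hu
    have hhu : ∀ k, h k = c k • u k := fun k => by rw [hu, smul_inv_smul₀ (hc0 k)]
    have hu1 : ∀ k, ‖u k‖ = 1 := fun k => by
      rw [hu, norm_smul, norm_inv, hcn, inv_mul_cancel₀ (hpos k).ne']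
    have hfix : ∀ k, (Y (φ k)).starProjection (T (m k) (u k)) = u k := fun k => by
      have := (starProjection_energyOp_eq_iff ha (B (m k)) (X (φ k)) (v k)).2 (hv k).2
      rw [hu, map_smul, map_smul]
      exact congrArg _ this
    obtain ⟨w', hw', huw⟩ := exists_fixed_near (u := u) hY (hTd μ).continuousAt (hTc μ) hφ hm
      (fun k => (hu1 k).le) (by simp only [hfix, sub_self]; exact tendsto_const_nhds)
    have huw0 : Tendsto (fun k => ‖u k - w' k‖) atTop (𝓝 0) := by simpa using huw.norm
    have hw'c : ∀ k, T μ (c k • w' k) = c k • w' k := fun k => by rw [map_smul, hw']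
    set w : ℕ → dom s := fun k => solve ha s (B μ (incl ha s (c k • w' k))) with hw
    have hwe : ∀ k, embed a s (w k) = c k • w' k := fun k => heig μ _ (hw'c k)
    have hvw : ∀ k, embed a s (v k - w k) = c k • (u k - w' k) := fun k => by
      rw [map_sub, hwe, smul_sub, ← hhu]
    have hw0 : ∀ᶠ k in atTop, w' k ≠ 0 := by
      filter_upwards [huw0.eventually_lt_const one_pos] with k hk h0
      rw [h0, sub_zero, hu1] at hk
      exact lt_irrefl _ hk
    refine ⟨w, ?_, ?_, ?_⟩
    · filter_upwards [hw0] with k hk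
      refine ⟨fun h0 => hk ?_, ?_⟩
      · have := hwe k
        rw [h0, map_zero] at this
        exact (smul_eq_zero.1 this.symm).resolve_left (hc0 k)
      · refine (energyOp_embed_eq_iff ha (B μ) (w k)).1 ?_
        rw [hwe]
        exact hw'c k
    · refine huw0.congr fun k => ?_
      rw [← norm_embed, ← norm_embed, hvw, norm_smul, hcn]
      exact (mul_div_cancel_left₀ _ (hpos k).ne').symm
    -- fixed points satisfy `‖w'‖ ≤ C ‖j w'‖`, so `‖j (u k)‖` is bounded below, while
    -- `‖j (u k - w' k)‖` tends to zero
    · set C := ‖green ha s ∘L B μ‖ with hC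
      set j := incl ha s with hj
      have hjw : ∀ k, ‖w' k‖ ≤ C * ‖j (w' k)‖ := fun k => by
        conv_lhs => rw [← hw' k]
        exact (green ha s ∘L B μ).le_opNorm (j (w' k))
      have hlow : ∀ᶠ k in atTop, 1 / 2 ≤ C * ‖j (u k)‖ := by
        have hlim := huw0.const_mul (1 + C * ‖j‖)
        rw [mul_zero] at hlim
        filter_upwards [hlim.eventually_lt_const (show (0 : ℝ) < 1 / 2 by norm_num)] with k hk
        have h1 : (1 : ℝ) ≤ ‖u k - w' k‖ + ‖w' k‖ := by
          rw [← hu1 k]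
          simpa using norm_add_le (u k - w' k) (w' k)
        have h2 : ‖j (w' k)‖ ≤ ‖j (u k)‖ + ‖j‖ * ‖u k - w' k‖ := by
          have e : j (w' k) = j (u k) - j (u k - w' k) := by rw [map_sub]; abel
          rw [e]
          exact (norm_sub_le _ _).trans (add_le_add_right (j.le_opNorm _) _)
        have h3 : C * ‖j (w' k)‖ ≤ C * (‖j (u k)‖ + ‖j‖ * ‖u k - w' k‖) :=
          mul_le_mul_of_nonneg_left h2 (hC ▸ ContinuousLinearMap.opNorm_nonneg _)
        linarith [hjw k]
      have hlim := huw0.const_mul (2 * C * ‖j‖)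
      rw [mul_zero] at hlim
      refine squeeze_zero' (Eventually.of_forall fun k => by positivity) ?_ hlim
      filter_upwards [hlow] with k hk
      have e1 : ((v k - w k : dom s) : H s) = c k • j (u k - w' k) := by
        rw [← incl_embed ha (v k - w k), hvw, map_smul]
      have e2 : (v k : H s) = c k • j (u k) := by
        rw [← incl_embed ha (v k), ← map_smul, ← hhu]
      have hju : 0 < ‖j (u k)‖ := by
        by_contra h0
        have : ‖j (u k)‖ = 0 := le_antisymm (not_lt.1 h0) (norm_nonneg _)
        rw [this, mul_zero] at hk
        norm_num at hk
      rw [e1, e2, norm_smul, norm_smul, hcn, mul_div_mul_left _ _ (hpos k).ne', div_le_iff₀ hju]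
      have h4 := j.le_opNorm (u k - w' k)
      have h5 : ‖j‖ * ‖u k - w' k‖ * (1 / 2) ≤ ‖j‖ * ‖u k - w' k‖ * (C * ‖j (u k)‖) := by
        gcongr
      linarith
  refine ⟨fun μ w hw => ?_, fun φ m v μ hφ hv hm => ?_, main⟩
  · have h0 : embed a s w ≠ 0 := fun h0 =>
      hw.1 (embed_injective a s (h0.trans (map_zero _).symm))
    have hfix : T μ (embed a s w) = embed a s w := (energyOp_embed_eq_iff ha (B μ) w).2 hw.2
    obtain ⟨m, hm, hlim⟩ := exists_seq_tendsto_of_forall_eventually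
      (S := fun n => {z | ∃ v, IsGalerkinEigenpair (diffOp a s (-1))
        (fun μ => (B μ : H s →ₗ[ℂ] H s)) (X n) z v}) (μ := μ) fun ε hε => by
        filter_upwards [exists_galerkin_eigenvalue_near hY hTd hTc hcount' h0 hfix hε]
          with n ⟨z, hz, y, hy0, hy⟩
        have hyY := (Y n).starProjection_apply_mem (T z y)
        rw [hy] at hyY
        obtain ⟨v, hv, rfl⟩ := hyY
        refine ⟨z, ⟨v, fun h => hy0 (by rw [h, map_zero]), ?_⟩, hz⟩
        exact (starProjection_energyOp_eq_iff ha (B z) (X n) v).1 hy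
    exact ⟨m, hm, hlim⟩
  · obtain ⟨w, hw, -⟩ := main φ m v μ hφ hv hm
    obtain ⟨k, hk⟩ := hw.exists
    exact ⟨w k, hk⟩

/-! ### Countability of the eigenvalues -/

theorem countable_eigenvalues (ha : 0 < a) (K : H s →L[ℂ] H s) :
    {μ | ∃ w, IsEigenpair (diffOp a s (-1))
      (fun μ : ℂ => μ • (K : H s →ₗ[ℂ] H s)) μ w}.Countable := by
  refine ((isCompactOperator_energyOp ha K).countable_setOf_eigenvalue.image
    fun z => z⁻¹).mono ?_
  rintro μ ⟨w, hw0, hw⟩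
  have hw : diffOp a s (-1) w = μ • K w := hw
  have hμ : μ ≠ 0 := by
    rintro rfl
    rw [zero_smul] at hw
    exact hw0 (diffOp_eq_zero ha hw)
  refine ⟨μ⁻¹, ⟨inv_ne_zero hμ, embed a s w, fun h0 =>
    hw0 (embed_injective a s (h0.trans (map_zero _).symm)), ?_⟩, inv_inv μ⟩
  rw [energyOp_embed, ← map_smul]
  congr 1
  rw [solve_eq_iff, map_smul, hw, inv_smul_smul₀ hμ]

theorem diffOp_eq_couple_iff (N : ℝ) (d : ℂ) (w : dom s) : diffOp a s (-1) w = couple N s d w ↔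
    fourthOp a s (compW s w) = (compT s w : L2 s) ∧
      (-1 : ℂ) • secondOp a s (compT s w) = d • weight N s (compW s w) := by
  constructor
  · intro h
    exact ⟨congrArg WithLp.fst h, congrArg WithLp.snd h⟩
  · rintro ⟨h1, h2⟩
    rw [diffOp_eq, h1, h2]
    rfl

/-- If `λ² = a² R` and `(W, Θ)` solves the system with eigenvalue `R`, then `(λ W, Θ)` solves
`A₊ w = λ K₊ w`. -/
theorem countable_eigenvalues_system (ha : 0 < a) (N s : ℝ) :
    {R : ℂ | ∃ w : dom s, w ≠ 0 ∧ diffOp a s (-1) w = couple N s (-(a ^ 2 * R)) w}.Countable := by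
  refine ((countable_eigenvalues ha (coupleL N s (-1))).image fun z => z ^ 2 / a ^ 2).mono ?_
  rintro R ⟨w, hw0, hw⟩
  obtain ⟨l, hl⟩ := IsAlgClosed.exists_pow_nat_eq (a ^ 2 * R) two_pos
  have ha' : (a : ℂ) ^ 2 ≠ 0 := pow_ne_zero 2 (Complex.ofReal_ne_zero.2 ha.ne')
  obtain ⟨h1, h2⟩ := (diffOp_eq_couple_iff N _ w).1 hw
  refine ⟨l, ⟨mkDom (l • compW s w) (compT s w), fun h0 => hw0 ?_, ?_⟩, ?_⟩
  · have hT : compT s w = 0 := Subtype.ext (congrArg (fun w : dom s => (w : H s).snd) h0)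
    have hW : compW s w = 0 := fourthOp_eq_zero ha (by rw [h1, hT]; rfl)
    refine diffOp_eq_zero ha ?_
    rw [diffOp_eq, hW, hT, map_zero, map_zero, smul_zero]
    rfl
  · change diffOp a s (-1) (mkDom (l • compW s w) (compT s w))
      = l • couple N s (-1) (mkDom (l • compW s w) (compT s w))
    have e : l • couple N s (-1) (mkDom (l • compW s w) (compT s w))
        = WithLp.toLp 2 (l • (compT s w : L2 s),
          l • (-1 : ℂ) • weight N s (l • (compW s w : L2 s))) := rfl
    rw [e, diffOp_mkDom, map_smul, h1, h2, map_smul, ← hl]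
    congr 2
    module
  · simp only [hl]
    exact mul_div_cancel_left₀ R ha'

/-! ### The three forms of the problem -/

theorem GalerkinConverges.congr {A A' : dom s →ₗ[ℂ] H s} {B B' : ℂ → H s →ₗ[ℂ] H s}
    {X : ℕ → Submodule ℂ (dom s)} (h : GalerkinConverges a A B X)
    (h1 : ∀ μ w, IsEigenpair A B μ w ↔ IsEigenpair A' B' μ w)
    (h2 : ∀ n μ w, IsGalerkinEigenpair A B (X n) μ w ↔ IsGalerkinEigenpair A' B' (X n) μ w) :
    GalerkinConverges a A' B' X := by
  obtain ⟨p, q, r⟩ := h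
  simp only [h1, h2] at p q r
  exact ⟨p, q, r⟩

/-- Testing the reflected problem with `v` is testing the original one with the reflection of `v`,
which stays in a product space; so both have the same Galerkin eigenpairs. -/
theorem isGalerkinEigenpair_reflect {A : dom s →ₗ[ℂ] H s} {B : ℂ → H s →ₗ[ℂ] H s}
    {A' : dom s →ₗ[ℂ] H s} {B' : ℂ → H s →ₗ[ℂ] H s} (hA : ∀ w, A' w = reflect s (A w))
    (hB : ∀ μ w, B' μ w = reflect s (B μ w)) {X : Submodule ℂ (dom s)} (hX : IsProductSpace X)
    (μ : ℂ) (w : dom s) : IsGalerkinEigenpair A B X μ w ↔ IsGalerkinEigenpair A' B' X μ w := by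
  obtain ⟨V, T, h⟩ := hX
  have hr : ∀ v ∈ X, (⟨reflect s v, reflect_mem v.2⟩ : dom s) ∈ X := by
    intro v hv
    obtain ⟨h1, h2⟩ := (h v).1 hv
    exact (h _).2 ⟨h1, T.neg_mem h2⟩
  have e : ∀ v : dom s, ⟪(v : H s), A' w - B' μ w⟫_ℂ
      = ⟪reflect s (v : H s), A w - B μ w⟫_ℂ := by
    intro v
    rw [hA, hB, ← map_sub, inner_reflect]
  refine and_congr_right fun _ => and_congr_right fun _ => ⟨fun hv v hvX => ?_, fun hv v hvX => ?_⟩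
  · rw [e]
    exact hv _ (hr v hvX)
  · have := hv _ (hr v hvX)
    rw [e] at this
    change ⟪reflect s (reflect s (v : H s)), A w - B μ w⟫_ℂ = 0 at this
    rwa [reflect_reflect] at this

theorem isEigenpair_reflect {A : dom s →ₗ[ℂ] H s} {B : ℂ → H s →ₗ[ℂ] H s}
    {A' : dom s →ₗ[ℂ] H s} {B' : ℂ → H s →ₗ[ℂ] H s} (hA : ∀ w, A' w = reflect s (A w))
    (hB : ∀ μ w, B' μ w = reflect s (B μ w))
    (μ : ℂ) (w : dom s) : IsEigenpair A B μ w ↔ IsEigenpair A' B' μ w := by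
  rw [IsEigenpair, IsEigenpair, hA, hB, (reflect_injective s).eq_iff]

theorem GalerkinConverges.reflect {A : dom s →ₗ[ℂ] H s} {B : ℂ → H s →ₗ[ℂ] H s}
    {A' : dom s →ₗ[ℂ] H s} {B' : ℂ → H s →ₗ[ℂ] H s} {X : ℕ → Submodule ℂ (dom s)}
    (h : GalerkinConverges a A B X) (hA : ∀ w, A' w = Convection.reflect s (A w))
    (hB : ∀ μ w, B' μ w = Convection.reflect s (B μ w)) (hX : ∀ n, IsProductSpace (X n)) :
    GalerkinConverges a A' B' X :=
  h.congr (isEigenpair_reflect hA hB) fun n => isGalerkinEigenpair_reflect hA hB (hX n)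

theorem galerkinConverges_couple (ha : 0 < a) (N : ℝ) {X : ℕ → Submodule ℂ (dom s)}
    (hX : IsTrialFamily a s X) :
    GalerkinConverges a (diffOp a s (-1)) (fun μ => μ • couple N s (-1)) X :=
  galerkinConverges ha (B := fun μ => μ • coupleL N s (-1)) (by fun_prop)
    (countable_eigenvalues ha (coupleL N s (-1))) hX

theorem galerkinConverges_system (ha : 0 < a) (N : ℝ) {X : ℕ → Submodule ℂ (dom s)}
    (hX : IsTrialFamily a s X) :
    GalerkinConverges a (diffOp a s (-1)) (fun R => couple N s (-(a ^ 2 * R))) X := by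
  set B : ℂ → H s →L[ℂ] H s := fun R =>
    coupleL N s 0 + R • (coupleL N s (-a ^ 2) - coupleL N s 0) with hB
  have e : (fun R => couple N s (-(a ^ 2 * R))) = fun R => (B R : H s →ₗ[ℂ] H s) := by
    funext R
    ext1 w
    change couple N s (-(a ^ 2 * R)) w
      = couple N s 0 w + R • (couple N s (-a ^ 2) w - couple N s 0 w)
    have h : ∀ d : ℂ, couple N s d w = WithLp.toLp 2 (w.snd, d • weight N s w.fst) := fun d => rfl
    rw [h, h, h, ← WithLp.toLp_sub, ← WithLp.toLp_smul, ← WithLp.toLp_add, Prod.mk_sub_mk,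
      Prod.smul_mk, Prod.mk_add_mk]
    congr 2
    · module
    · module
  have hc := countable_eigenvalues_system ha N s
  rw [e]
  refine galerkinConverges ha (by fun_prop) (hc.mono ?_) hX
  rintro R ⟨w, hw0, hw⟩
  exact ⟨w, hw0, hw.trans (congrFun (congrArg DFunLike.coe (congrFun e R)) (w : H s)).symm⟩

theorem diffOp_one_eq_couple_iff (N : ℝ) (u : H s) (y : dom s) :
    diffOp a s 1 y = couple N s 1 u ↔ diffOp a s (-1) y = couple N s (-1) u := by
  rw [diffOp_one, couple_eq_reflect, (reflect_injective s).eq_iff]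

end Convection

end

open Convection
open scoped InnerProductSpace
theorem mainTheorem2 (a N s : ℝ) (ha : 0 < a) :
    -- `diag ((D² - a²)², a² - D²)` is positive-definite and self-adjoint
    (Dense (dom s : Set (H s)) ∧ IsSelfAdjoint (opA a s (-1)) ∧
      ∃ γ > 0, ∀ w : dom s, γ * ‖(w : H s)‖ ^ 2 ≤ (⟪diffOp a s (-1) w, (w : H s)⟫_ℂ).re) ∧
    -- `A = diag ((D² - a²)², D² - a²)` is self-adjoint and maps its domain bijectively onto `L²`
    (IsSelfAdjoint (opA a s 1) ∧ Function.Bijective (diffOp a s 1)) ∧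
    -- `A⁻¹ K` extends to a compact operator on `H₀`, and it is compact on `L²`
    (∃ T : H0 a s →L[ℂ] H0 a s, IsCompactOperator T ∧
      ∀ u y : dom s, diffOp a s 1 y = couple N s 1 u → T (toH0 a s u) = toH0 a s y) ∧
    (∃ T : H s →L[ℂ] H s, IsCompactOperator T ∧
      ∀ (u : H s) (y : dom s), diffOp a s 1 y = couple N s 1 u → T u = y) ∧
    -- convergence for the positive-definite form of `A w - λ K w = 0`, any trial spaces
    (∀ X : ℕ → Submodule ℂ (dom s), IsTrialFamily a s X →
      GalerkinConverges a (diffOp a s (-1)) (fun μ => μ • couple N s (-1)) X) ∧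
    -- convergence for `A w - λ K w = 0` itself, and for the system in the form
    -- `(D² - a²)² W = Θ`, `(D² - a²) Θ = -a² R (1 - N (x - s)) W` with eigenvalue `R`,
    -- when `W` and `Θ` are expanded separately
    (∀ X : ℕ → Submodule ℂ (dom s), IsTrialFamily a s X → (∀ n, IsProductSpace (X n)) →
      GalerkinConverges a (diffOp a s 1) (fun μ => μ • couple N s 1) X ∧
      GalerkinConverges a (diffOp a s 1) (fun R => couple N s (a ^ 2 * R)) X) := by
  refine ⟨⟨dense_dom ha s, isSelfAdjoint_opA ha s, exists_coercive ha s⟩,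
    ⟨isSelfAdjoint_opA_one ha s, bijective_diffOp_one ha s⟩,
    ⟨energyOp ha (coupleL N s (-1)), isCompactOperator_energyOp ha _, fun u y h => ?_⟩,
    ⟨(incl ha s ∘L green ha s) ∘L coupleL N s (-1),
      (isCompactOperator_incl_green ha s).comp_clm (coupleL N s (-1)), fun u y h => ?_⟩,
    fun X hX => galerkinConverges_couple ha N hX, fun X hX hp =>
      ⟨(galerkinConverges_couple ha N hX).reflect diffOp_one (fun μ w => ?_) hp,
      (galerkinConverges_system ha N hX).reflect diffOp_one
        (fun R w => couple_eq_reflect _ _ _) hp⟩⟩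
  · have h1 := (solve_eq_iff ha).2 ((diffOp_one_eq_couple_iff N (u : H s) y).1 h)
    exact (energyOp_embed ha (coupleL N s (-1)) u).trans (congrArg (embed a s) h1)
  · have h1 := (solve_eq_iff ha).2 ((diffOp_one_eq_couple_iff N u y).1 h)
    exact (incl_green ha (couple N s (-1) u)).trans (congrArg Subtype.val h1)
  · change μ • couple N s 1 w = reflect s (μ • couple N s (-1) w)
    rw [map_smul, couple_eq_reflect]
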